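/- **Setting.** All quantities are indexed by a sequence along which $n,p\to\infty$. Let $S\subseteq\{1,\dots,p\}$ be a nonempty core set with $s=|S|$. The rows of the design $\mathbf X\in\mathbb R^{n\times p}$ are independent and $N(0,\mathbf\Sigma)$ with $\mathbf\Sigma_{jj}=1$ for all $j$, and in each row $$X_j=X_S\Gamma_j+\epsilon_j,\qquad j\notin S,$$ for fixed coefficient vectors $\Gamma_j\in\mathbb R^s$, where the $\epsilon_j\sim N(0,\sigma_j^2)$, $\sigma_j^2\in(0,1]$, are mutually independent and jointly independent of $X_S$. The response is $Y=\beta_0^*+\mathbf X_S\beta^*_S+\epsilon$, where $\epsilon\in\mathbb R^n$ has i.i.d. $N(0,\sigma^2)$ entries, $\sigma>0$, and is independent of $\mathbf X$. Let $\beta_{\min}=\min_{i\in S}|\beta^*_i|$. Let $w_1,\dots,w_p\in(0,\infty]$ be any weights that are (measurable) functions of $\mathbf X$, and let $\hat\beta_0\in\mathbb R,\hat\beta\in\mathbb R^p$ be any minimizer of the adaptive lasso objective $$\tfrac12\|Y-\beta_0-\mathbf X\beta\|_2^2+\lambda\sum_j w_j|\beta_j|,$$ where $\lambda>0$ (possibly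 random) and $w_j=\infty$ imposes the constraint $\beta_j=0$. Put $\hat S=\{i:\hat\beta_i\ne0\}$, $\lambda_n=\lambda/n$, $w_{\max}(S)=\max_{i\in S}w_i$, $w_{\min}(S^C)=\min_{i\notin S}w_i$ (equal to $\infty$ if $S^C=\emptyset$), and $\rho=w_{\max}(S)/w_{\min}(S^C)$, with the conventions $\infty/\infty=\infty$ and $1/\infty=0$. For random quantities, "$a\ll b$ with probability approaching 1" (equivalently $b\gg a$) means that $P[Ma\le b]\to1$ for every constant $M\geq 0$. **Theorem 2.** Suppose $s\ll n$; the smallest eigenvalue of $\mathbf\Sigma_{SS}$ is at least a fixed constant $C_{\min}>0$; and, for some fixed $\eta\in(0,1]$, with probability approaching 1, $$\rho\sqrt{\frac{s}{C_{\min}}}\left(1+\sqrt{\frac{12\log p}{n}}\right)\le1-\eta .$$ (a) If, with probability approaching 1, $$\lambda_n\gg\frac{1}{w_{\min}(S^C)}\,\sigma\sqrt{\frac{\log p}{n}\left(1+\frac{\log p}{n}\right)},$$ then $P[\hat S\subseteq S]\to1$. (b) If, in addition, $$\beta_{\min}\gg\sigma\sqrt{\frac{s\log p}{n}\left(1+\frac{\log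 p}{n}\right)}$$ and $\lambda_n\ll\beta_{\min}/(w_{\max}(S)\sqrt s)$ with probability approaching 1, then $P[\hat S=S]\to1$. -/

import Mathlib

open MeasureTheory ProbabilityTheory Filter Topology Asymptotics
open scoped ENNReal NNReal

namespace HubNet

/-- The residual vector `ε_j = X_j - X_S Γ_j`, `j ∉ S`, of a feature vector `x`. -/
def residual {p : ℕ} (S : Finset (Fin p)) (Γ : S → {j // j ∉ S} → ℝ) (x : Fin p → ℝ) :
    {j // j ∉ S} → ℝ :=
  fun j => x j.1 - ∑ l : S, x l.1 * Γ l j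

/-- The design `X` (an `n × p` random matrix, `X ω i j`) has independent rows distributed as
`N(0, Sig)` with `Sig j j = 1`, and it follows the hub model with core set `S`: in every row,
`X_j = X_S Γ_j + ε_j` for `j ∉ S`, where the `ε_j` are independent centred Gaussian variables with
variances `v j > 0`, jointly independent of `X_S`. -/
structure IsHubDesign {Ω : Type*} [MeasurableSpace Ω] (P : Measure Ω) {n p : ℕ}
    (X : Ω → Fin n → Fin p → ℝ) (Sig : Matrix (Fin p) (Fin p) ℝ) (S : Finset (Fin p)) : Prop where
  posSemidef : Sig.PosSemidef
  diag_eq_one : ∀ j, Sig j j = 1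
  indep_rows : iIndepFun (fun i ω => X ω i) P
  law_rows : ∀ i, HasLaw (fun ω => WithLp.toLp 2 (X ω i)) (multivariateGaussian 0 Sig) P
  core_model : ∃ (Γ : S → {j // j ∉ S} → ℝ) (v : {j // j ∉ S} → ℝ≥0), (∀ j, 0 < v j) ∧
    ∀ i,
      (∀ j, HasLaw (fun ω => residual S Γ (X ω i) j) (gaussianReal 0 (v j)) P) ∧
      iIndepFun (fun j ω => residual S Γ (X ω i) j) P ∧
      IndepFun (fun ω (l : S) => X ω i l.1) (fun ω => residual S Γ (X ω i)) P

/-- The response vector `Y = β₀ + X_S β_S + ε`. -/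
def response {n p : ℕ} (S : Finset (Fin p)) (b0 : ℝ) (b : Fin p → ℝ)
    (X : Fin n → Fin p → ℝ) (e : Fin n → ℝ) : Fin n → ℝ :=
  fun i => b0 + ∑ j ∈ S, X i j * b j + e i

/-- The adaptive lasso objective `½‖Y - b₀ - X b‖₂² + lam ∑ⱼ wⱼ |bⱼ|` with weights in `(0, ∞]`.
For `lam > 0` a weight `wⱼ = ∞` makes the objective infinite unless `bⱼ = 0`
(since `∞ * 0 = 0` in `ℝ≥0∞`), which is the hard constraint `bⱼ = 0`. -/
noncomputable def objective {n p : ℕ} (X : Fin n → Fin p → ℝ) (Y : Fin n → ℝ) (lam : ℝ)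
    (w : Fin p → ℝ≥0∞) (b0 : ℝ) (b : Fin p → ℝ) : ℝ≥0∞ :=
  ENNReal.ofReal ((1 / 2) * ∑ i, (Y i - b0 - ∑ j, X i j * b j) ^ 2) +
    ENNReal.ofReal lam * ∑ j, w j * ENNReal.ofReal |b j|

/-- `(b0, b)` minimizes the adaptive lasso objective. -/
def IsAdaptiveLasso {n p : ℕ} (X : Fin n → Fin p → ℝ) (Y : Fin n → ℝ) (lam : ℝ)
    (w : Fin p → ℝ≥0∞) (b0 : ℝ) (b : Fin p → ℝ) : Prop :=
  ∀ (c0 : ℝ) (c : Fin p → ℝ), objective X Y lam w b0 b ≤ objective X Y lam w c0 c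

/-- `w_max(S)`. -/
noncomputable def wMax {p : ℕ} (S : Finset (Fin p)) (w : Fin p → ℝ≥0∞) : ℝ≥0∞ := ⨆ j ∈ S, w j

/-- `w_min(Sᶜ)`. -/
noncomputable def wMin {p : ℕ} (S : Finset (Fin p)) (w : Fin p → ℝ≥0∞) : ℝ≥0∞ := ⨅ j ∉ S, w j

open Classical in
/-- `ρ = w_max(S) / w_min(Sᶜ)` with the convention `∞ / ∞ = ∞`
(Mathlib's division in `ℝ≥0∞` has `∞ / ∞ = 0`). -/
noncomputable def rho {p : ℕ} (S : Finset (Fin p)) (w : Fin p → ℝ≥0∞) : ℝ≥0∞ :=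
  if wMax S w = ∞ then ∞ else wMax S w / wMin S w

/-- The events `E k` hold with probability approaching one. -/
def WHP {Ω : ℕ → Type*} [∀ k, MeasurableSpace (Ω k)] (P : ∀ k, Measure (Ω k))
    (E : ∀ k, Set (Ω k)) : Prop :=
  Tendsto (fun k => P k (E k)) atTop (𝓝 1)

/-- `a ≪ b` with probability approaching one: for every constant `M`,
`P[M a ≤ b] → 1`. -/
def LLWHP {Ω : ℕ → Type*} [∀ k, MeasurableSpace (Ω k)] (P : ∀ k, Measure (Ω k))
    (a b : ∀ k, Ω k → ℝ≥0∞) : Prop :=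
  ∀ M : ℝ≥0, WHP P (fun k => {ω | M * a k ω ≤ b k ω})

/-- The noise level `σ √((log p / n) (1 + log p / n))`. -/
noncomputable def noiseLevel (σ : ℝ) (n p : ℕ) : ℝ :=
  σ * √((Real.log p / n) * (1 + Real.log p / n))

end HubNet

namespace HubNet

/-! ### Chi-square tails of projected Gaussian vectors -/

/-! The argument separates a deterministic recovery statement on good samples (`GoodSample`) from a
bound on the probability of a bad sample. Centring the columns removes the intercept. With `L = log
p`, `V` the span of the centred core columns and `r` the residual of the fit, optimality gives
`|⟨x_j, r⟩| ≤ λ w_j`, and `λ w_j |b_j| ≤ b_j ⟨x_j, r⟩`, for finite weights.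

No false positives: sum the second inequality over `j ∉ S` with `z = ∑ b_j x_j`. Splitting `r` along
`V` and its complement, `⟨z, r⟩` equals `⟨z, P r⟩ + ⟨z - P z, e⟩ - ‖z - P z‖²`, and the last term
has the favourable sign. So `b_j = 0` off `S` as soon as `|⟨x_j, P r⟩| + |⟨x_j - P x_j, e⟩| < λ w_j`
there (`eq_zero_of_dual_feasible`); this applies to every minimizer, without uniqueness or a
constructed witness. In the hub model `P x_j` has coefficients `Γ_j + θ` in the core columns, where
`‖Γ_j‖ ≤ 1/√Cmin` by unit variance and `θ` represents the projection of an independent error onto at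
most `s` dimensions. Hence the first term is at most `λ w_max(S) √(s/Cmin) (1 + √(4s/n + 12L/n))`,
which the weight gap controls; the lower bound on `λ` controls the second.

No false negatives: once `b` is supported on `S`, the Gram bound gives `‖β - b‖ ≤ ‖P e‖/k + √s λ
w_max(S)/k²` with `k² = n Cmin/2` (`norm_error_le`). The signal conditions make this at most
`β_min/2`.

Good samples are typical by chi-square tails for projected Gaussians, applied conditionally on the
subspace, and by a net argument for the Gram matrix, whose factor `9^s` is harmless since `s ≪ n`.
-/

lemma integral_exp_sq_gaussianReal {t : ℝ} (ht : t < 1 / 2) :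
    ∫ x, Real.exp (t * x ^ 2) ∂(gaussianReal 0 1) = (√(1 - 2 * t))⁻¹ := by
  rw [integral_gaussianReal_eq_integral_smul one_ne_zero]
  have h (x : ℝ) : gaussianPDFReal 0 1 x • Real.exp (t * x ^ 2) =
      (√(2 * Real.pi))⁻¹ * Real.exp (-(1 / 2 - t) * x ^ 2) := by
    simp only [gaussianPDFReal, NNReal.coe_one, mul_one, sub_zero, smul_eq_mul, mul_assoc,
      ← Real.exp_add]
    congr 2; ring
  simp_rw [h]
  rw [integral_const_mul, integral_gaussian, ← Real.sqrt_inv, ← Real.sqrt_inv,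
    ← Real.sqrt_mul (by positivity)]
  congr 1
  have : (0 : ℝ) < 1 - 2 * t := by linarith
  have h2 : (0 : ℝ) < 1 / 2 - t := by linarith
  have := Real.pi_pos
  field_simp

section StdGaussian

variable {E : Type*} [NormedAddCommGroup E] [InnerProductSpace ℝ E] [FiniteDimensional ℝ E]
  [MeasurableSpace E] [BorelSpace E]

/-- In an orthonormal basis the squared norm is a sum of squares of independent standard normals, so
the moment generating function factorizes. -/
lemma mgf_norm_sq_stdGaussian {t : ℝ} (ht : t < 1 / 2) :
    mgf (fun x : E => ‖x‖ ^ 2) (stdGaussian E) t = (√(1 - 2 * t))⁻¹ ^ Module.finrank ℝ E := by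
  have hn (x : Fin (Module.finrank ℝ E) → ℝ) :
      ‖∑ i, x i • stdOrthonormalBasis ℝ E i‖ ^ 2 = ∑ i, x i ^ 2 := by
    rw [← (stdOrthonormalBasis ℝ E).sum_sq_norm_inner_right]
    simp [inner_sum, inner_smul_right, OrthonormalBasis.inner_eq_ite]
  rw [mgf, stdGaussian, integral_map (Measurable.aemeasurable (by fun_prop))
    (Measurable.aestronglyMeasurable (by fun_prop))]
  simp_rw [hn, Finset.mul_sum, Real.exp_sum]
  rw [integral_fintype_prod_eq_prod (f := fun _ x => Real.exp (t * x ^ 2))]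
  simp_rw [integral_exp_sq_gaussianReal ht]
  simp

/-- For `t ∈ V` one has `⟨P x, t⟩ = ⟨x, t⟩`, so both characteristic functions are `exp (-‖t‖² / 2)`.
-/
lemma map_orthogonalProjection_stdGaussian (V : Submodule ℝ E) :
    (stdGaussian E).map V.orthogonalProjectionOnto = stdGaussian V := by
  apply Measure.ext_of_charFun
  ext t
  rw [charFun_stdGaussian, charFun_apply, integral_map (by fun_prop)
    (Measurable.aestronglyMeasurable (by fun_prop))]
  simp_rw [Submodule.inner_orthogonalProjectionOnto_eq_of_mem_right]
  rw [← charFun_apply, charFun_stdGaussian]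
  simp

lemma mgf_starProjection_stdGaussian (V : Submodule ℝ E) {t : ℝ} (ht : t < 1 / 2) :
    mgf (fun x => ‖V.starProjection x‖ ^ 2) (stdGaussian E) t =
      (√(1 - 2 * t))⁻¹ ^ Module.finrank ℝ V := by
  rw [← mgf_norm_sq_stdGaussian ht, ← map_orthogonalProjection_stdGaussian V, mgf_map]
  · rfl
  · fun_prop
  · exact Measurable.aestronglyMeasurable (by fun_prop)

lemma integrable_exp_starProjection_stdGaussian (V : Submodule ℝ E) {t : ℝ} (ht : t < 1 / 2) :
    Integrable (fun x => Real.exp (t * ‖V.starProjection x‖ ^ 2)) (stdGaussian E) := by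
  by_contra h
  have h1 := mgf_starProjection_stdGaussian V ht
  -- A non-integrable function has integral `0` by convention, whereas the formula gives a positive
  -- value.
  rw [mgf, integral_undef h] at h1
  have : (0 : ℝ) < 1 - 2 * t := by linarith
  have : 0 < (√(1 - 2 * t))⁻¹ ^ Module.finrank ℝ V := by positivity
  linarith

lemma stdGaussian_starProjection_ge (V : Submodule ℝ E) {t : ℝ} (ht0 : 0 ≤ t) (ht : t < 1 / 2)
    (T : ℝ) :
    (stdGaussian E).real {x | T ≤ ‖V.starProjection x‖ ^ 2} ≤
      Real.exp (-t * T) * (√(1 - 2 * t))⁻¹ ^ Module.finrank ℝ V := by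
  rw [← mgf_starProjection_stdGaussian V ht]
  exact measure_ge_le_exp_mul_mgf T ht0 (integrable_exp_starProjection_stdGaussian V ht)

lemma stdGaussian_starProjection_le (V : Submodule ℝ E) {t : ℝ} (ht0 : t ≤ 0) (T : ℝ) :
    (stdGaussian E).real {x | ‖V.starProjection x‖ ^ 2 ≤ T} ≤
      Real.exp (-t * T) * (√(1 - 2 * t))⁻¹ ^ Module.finrank ℝ V := by
  rw [← mgf_starProjection_stdGaussian V (by linarith)]
  exact measure_le_le_exp_mul_mgf T ht0 (integrable_exp_starProjection_stdGaussian V (by linarith))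

end StdGaussian

/-- The law of a vector with `n` independent `N(0, v)` entries. -/
noncomputable def gaussVec (n : ℕ) (v : ℝ≥0) : Measure (EuclideanSpace ℝ (Fin n)) :=
  (Measure.pi fun _ => gaussianReal 0 v).map (WithLp.toLp 2)

instance (n : ℕ) (v : ℝ≥0) : IsProbabilityMeasure (gaussVec n v) :=
  Measure.isProbabilityMeasure_map (by fun_prop)

lemma gaussVec_one (n : ℕ) : gaussVec n 1 = stdGaussian (EuclideanSpace ℝ (Fin n)) :=
  map_pi_eq_stdGaussian

lemma gaussVec_eq_map (n : ℕ) (v : ℝ≥0) :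
    gaussVec n v = (stdGaussian (EuclideanSpace ℝ (Fin n))).map (fun x => √(v : ℝ) • x) := by
  have h : gaussianReal 0 v = (gaussianReal 0 1).map (√(v : ℝ) * ·) := by
    rw [gaussianReal_map_const_mul]
    congr 1
    · simp
    · ext; simp
  rw [← gaussVec_one, gaussVec, gaussVec, h, ← Measure.pi_map_pi (by fun_prop),
    Measure.map_map (by fun_prop) (by fun_prop), Measure.map_map (by fun_prop) (by fun_prop)]
  rfl

/-- Upper tail of the norm of a projected Gaussian vector. -/
lemma gaussVec_starProjection_ge {n : ℕ} {v : ℝ≥0} (hv : 0 < v)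
    (V : Submodule ℝ (EuclideanSpace ℝ (Fin n))) (T : ℝ) {d : ℕ} (hd : Module.finrank ℝ V ≤ d) :
    (gaussVec n v).real {x | v * T ≤ ‖V.starProjection x‖ ^ 2} ≤
      Real.exp (-T / 4) * √2 ^ d := by
  rw [gaussVec_eq_map, map_measureReal_apply (by fun_prop)
    (measurableSet_le (by fun_prop) (by fun_prop))]
  have h : (fun x => √(v : ℝ) • x) ⁻¹' {x | v * T ≤ ‖V.starProjection x‖ ^ 2} =
      {x | T ≤ ‖V.starProjection x‖ ^ 2} := by
    ext x
    simp only [Set.mem_preimage, Set.mem_ofPred_eq, map_smul, norm_smul, mul_pow, Real.norm_eq_abs,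
      sq_abs, Real.sq_sqrt (NNReal.coe_nonneg v)]
    exact mul_le_mul_iff_right₀ (NNReal.coe_pos.2 hv)
  rw [h]
  -- The Chernoff parameter `1/4` costs a factor `√2` per dimension; as `√2 ≥ 1`, an upper bound on
  -- the dimension suffices.
  refine (stdGaussian_starProjection_ge V (t := 1 / 4) (by norm_num) (by norm_num) T).trans ?_
  have h2 : (√(1 - 2 * (1 / 4) : ℝ))⁻¹ = √2 := by
    rw [← Real.sqrt_inv]; norm_num
  rw [h2]
  gcongr
  · linarith
  · exact Real.one_le_sqrt.2 (by norm_num)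

/-- Tail of a linear functional of a Gaussian vector. -/
lemma gaussVec_inner_sq_gt {n : ℕ} {v : ℝ≥0} (hv : 0 < v) (h : EuclideanSpace ℝ (Fin n)) (T : ℝ) :
    (gaussVec n v).real {x | v * T * ‖h‖ ^ 2 < inner ℝ h x ^ 2} ≤ Real.exp (-T / 4) * √2 := by
  have hd : Module.finrank ℝ (ℝ ∙ h) ≤ 1 := by
    simpa using finrank_span_le_card ({h} : Set (EuclideanSpace ℝ (Fin n)))
  -- Only the component of `x` along `h` matters, by Cauchy–Schwarz. The strict inequality makes the
  -- event empty when `h = 0`.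
  refine (measureReal_mono ?_).trans ((gaussVec_starProjection_ge hv (ℝ ∙ h) T hd).trans_eq
    (by rw [pow_one]))
  intro x hx
  simp only [Set.mem_ofPred_eq] at hx ⊢
  by_contra! hc
  have h1 : inner ℝ h x = inner ℝ h ((ℝ ∙ h).starProjection x) := by
    rw [← Submodule.inner_starProjection_left_eq_right,
      Submodule.starProjection_eq_self_iff.2 (Submodule.mem_span_singleton_self h)]
  have h2 : inner ℝ h x ^ 2 ≤ ‖h‖ ^ 2 * ‖(ℝ ∙ h).starProjection x‖ ^ 2 := by
    rw [h1, ← sq_abs, ← mul_pow]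
    gcongr
    exact abs_real_inner_le_norm _ _
  nlinarith [sq_nonneg ‖h‖]

lemma finrank_orthogonal_singleton_ge (n : ℕ) (h : EuclideanSpace ℝ (Fin n)) :
    n ≤ Module.finrank ℝ (ℝ ∙ h)ᗮ + 1 := by
  have h1 := (ℝ ∙ h).finrank_add_finrank_orthogonal
  have hd : Module.finrank ℝ (ℝ ∙ h) ≤ 1 := by
    simpa using finrank_span_le_card ({h} : Set (EuclideanSpace ℝ (Fin n)))
  simp at h1
  omega

/-- The squared norm of a centred standard Gaussian vector concentrates around `n`. -/
lemma gaussVec_centered_concentration (n : ℕ) (h : EuclideanSpace ℝ (Fin n)) :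
    (gaussVec n 1).real {x | ¬ |‖(ℝ ∙ h)ᗮ.starProjection x‖ ^ 2 - n| ≤ n / 4} ≤
      3 * Real.exp (-(n : ℝ) / 128) := by
  set V := (ℝ ∙ h)ᗮ
  have hV1 : n ≤ Module.finrank ℝ V + 1 := finrank_orthogonal_singleton_ge n h
  have hV2 : Module.finrank ℝ V ≤ n := by simpa using Submodule.finrank_le V
  rw [gaussVec_one]
  have hsub : {x | ¬ |‖V.starProjection x‖ ^ 2 - n| ≤ n / 4} ⊆
      {x | (5 / 4 * n : ℝ) ≤ ‖V.starProjection x‖ ^ 2} ∪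
      {x | ‖V.starProjection x‖ ^ 2 ≤ (3 / 4 * n : ℝ)} := by
    intro x hx
    simp only [Set.mem_ofPred_eq, abs_le, not_and_or, not_le, Set.mem_union] at hx ⊢
    rcases hx with hx | hx
    · right; linarith
    · left; linarith
  -- With parameters `±1/16` the exponents per dimension are `-5/64 + 9/128 = -1/128` above and
  -- `3/64 - 1/18 < -1/128` below. Centring loses at most one dimension, which costs the lower tail
  -- a factor `exp (1/18) ≤ 2`; hence the total constant `3`.
  have hup := stdGaussian_starProjection_ge V (t := 1 / 16) (by norm_num) (by norm_num) (5 / 4 * n)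
  have hlo := stdGaussian_starProjection_le V (t := -1 / 16) (by norm_num) (3 / 4 * n)
  have e1 : (√(1 - 2 * (1 / 16) : ℝ))⁻¹ ≤ Real.exp (9 / 128) := by
    rw [← Real.sqrt_inv, Real.sqrt_le_left (Real.exp_pos _).le, ← Real.exp_nat_mul]
    refine le_trans ?_ (Real.quadratic_le_exp_of_nonneg (by norm_num))
    norm_num
  have e1' : 1 ≤ (√(1 - 2 * (1 / 16) : ℝ))⁻¹ := by
    rw [← Real.sqrt_inv]
    exact Real.one_le_sqrt.2 (by norm_num)
  have e2 : (√(1 - 2 * (-1 / 16) : ℝ))⁻¹ ≤ Real.exp (-1 / 18) := by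
    rw [← Real.sqrt_inv, Real.sqrt_le_left (Real.exp_pos _).le, ← Real.exp_nat_mul]
    refine le_trans ?_ (Real.add_one_le_exp _)
    norm_num
  have b1 : (stdGaussian (EuclideanSpace ℝ (Fin n))).real
      {x | (5 / 4 * n : ℝ) ≤ ‖V.starProjection x‖ ^ 2} ≤ Real.exp (-(n : ℝ) / 128) := by
    refine hup.trans ?_
    calc Real.exp (-(1 / 16) * (5 / 4 * n)) * (√(1 - 2 * (1 / 16) : ℝ))⁻¹ ^ Module.finrank ℝ V
        ≤ Real.exp (-(1 / 16) * (5 / 4 * n)) * Real.exp (9 / 128) ^ n := by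
          gcongr ?_ * ?_
          exact (pow_le_pow_right₀ e1' hV2).trans (by gcongr)
      _ = Real.exp (-(n : ℝ) / 128) := by
          rw [← Real.exp_nat_mul, ← Real.exp_add]
          congr 1; ring
  have b2 : (stdGaussian (EuclideanSpace ℝ (Fin n))).real
      {x | ‖V.starProjection x‖ ^ 2 ≤ (3 / 4 * n : ℝ)} ≤ 2 * Real.exp (-(n : ℝ) / 128) := by
    refine hlo.trans ?_
    calc Real.exp (-(-1 / 16) * (3 / 4 * n)) * (√(1 - 2 * (-1 / 16) : ℝ))⁻¹ ^ Module.finrank ℝ V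
        ≤ Real.exp (-(-1 / 16) * (3 / 4 * n)) * Real.exp (-1 / 18) ^ Module.finrank ℝ V := by
          gcongr
      _ = Real.exp (-(-1 / 16) * (3 / 4 * n) + Module.finrank ℝ V * (-1 / 18)) := by
          rw [← Real.exp_nat_mul, ← Real.exp_add]
      _ ≤ Real.exp (1 / 18 + -(n : ℝ) / 128) := by
          apply Real.exp_le_exp.2
          have : (n : ℝ) ≤ Module.finrank ℝ V + 1 := by exact_mod_cast hV1
          linarith [(Nat.cast_nonneg n : (0 : ℝ) ≤ n)]
      _ ≤ 2 * Real.exp (-(n : ℝ) / 128) := by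
          rw [Real.exp_add]
          gcongr
          have := Real.exp_bound_div_one_sub_of_interval' (x := 1 / 18) (by norm_num) (by norm_num)
          norm_num at this ⊢
          linarith
  calc _ ≤ _ := measureReal_mono hsub
    _ ≤ _ := measureReal_union_le _ _
    _ ≤ _ := by linarith

/-! ### Nets of the unit sphere -/

section Net

variable {E : Type*} [NormedAddCommGroup E] [NormedSpace ℝ E] [FiniteDimensional ℝ E]

/-- A `1/4`-separated subset of the unit ball has at most `9 ^ dim` elements. -/
lemma card_le_of_quarter_separated (s : Finset E) (hs : ∀ c ∈ s, ‖c‖ ≤ 1)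
    (h : ∀ c ∈ s, ∀ d ∈ s, c ≠ d → 1 / 4 < ‖c - d‖) : s.card ≤ 9 ^ Module.finrank ℝ E := by
  borelize E
  let μ : Measure E := Measure.addHaar
  -- Volume comparison: the balls of radius `1/8` about the points are disjoint and lie in a ball of
  -- radius `9/8`.
  have D : Set.Pairwise (s : Set E) (Function.onFun Disjoint fun c => Metric.ball (c : E) (1 / 8)) := by
    rintro c hc d hd hcd
    apply Metric.ball_disjoint_ball
    rw [dist_eq_norm]
    linarith [h c hc d hd hcd]
  have hsub : (⋃ c ∈ s, Metric.ball (c : E) (1 / 8)) ⊆ Metric.ball (0 : E) (9 / 8) := by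
    refine Set.iUnion₂_subset fun x hx => ?_
    apply Metric.ball_subset_ball'
    rw [dist_zero_right]
    linarith [hs x hx]
  have I : (s.card : ℝ≥0∞) * ENNReal.ofReal ((1 / 8) ^ Module.finrank ℝ E) * μ (Metric.ball 0 1) ≤
      ENNReal.ofReal ((9 / 8) ^ Module.finrank ℝ E) * μ (Metric.ball 0 1) :=
    calc
      _ = μ (⋃ c ∈ s, Metric.ball (c : E) (1 / 8)) := by
        rw [measure_biUnion_finset D fun c _ => measurableSet_ball]
        simp only [μ.addHaar_ball_of_pos _ (show (0 : ℝ) < 1 / 8 by norm_num)]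
        simp only [Finset.sum_const, nsmul_eq_mul, mul_assoc]
      _ ≤ μ (Metric.ball (0 : E) (9 / 8)) := measure_mono hsub
      _ = _ := by simp only [μ.addHaar_ball_of_pos _ (show (0 : ℝ) < 9 / 8 by norm_num)]
  have J := (ENNReal.mul_le_mul_iff_left
    (Metric.measure_ball_pos _ _ zero_lt_one).ne' measure_ball_lt_top.ne).1 I
  have K : (s.card : ℝ) ≤ (9 : ℝ) ^ Module.finrank ℝ E := by
    have := ENNReal.toReal_le_of_le_ofReal (by positivity) J
    simpa [div_eq_mul_inv, mul_pow] using this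
  exact mod_cast K

/-- The unit sphere has a `1/4`-net of at most `9 ^ dim` points. -/
lemma exists_sphere_net :
    ∃ N : Finset E, N.card ≤ 9 ^ Module.finrank ℝ E ∧ (∀ y ∈ N, ‖y‖ = 1) ∧
      ∀ x : E, ‖x‖ = 1 → ∃ y ∈ N, ‖x - y‖ ≤ 1 / 4 := by
  classical
  -- A separated set of maximal cardinality is a net, since any point far from all of it could be
  -- added.
  let Q : ℕ → Prop := fun m => ∃ N : Finset E, N.card = m ∧ (∀ y ∈ N, ‖y‖ = 1) ∧
    ∀ c ∈ N, ∀ d ∈ N, c ≠ d → 1 / 4 < ‖c - d‖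
  have hQ0 : Q 0 := ⟨∅, by simp⟩
  have hb : ∀ m, Q m → m ≤ 9 ^ Module.finrank ℝ E := by
    rintro m ⟨N, rfl, h1, h2⟩
    exact card_le_of_quarter_separated N (fun c hc => (h1 c hc).le) h2
  obtain ⟨N, hN, h1, h2⟩ := Nat.findGreatest_spec (P := Q) (Nat.zero_le _) hQ0
  refine ⟨N, hN ▸ Nat.findGreatest_le _, h1, fun x hx => ?_⟩
  by_contra! hc
  have hxN : x ∉ N := fun hxN => by have := hc x hxN; simp at this; linarith
  have hQ : Q (N.card + 1) := by
    refine ⟨insert x N, Finset.card_insert_of_notMem hxN, ?_, ?_⟩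
    · simp only [Finset.mem_insert, forall_eq_or_imp]
      exact ⟨hx, h1⟩
    · intro c hc' d hd hcd
      rcases Finset.mem_insert.1 hc' with rfl | hcN <;>
        rcases Finset.mem_insert.1 hd with rfl | hd
      · exact absurd rfl hcd
      · exact hc d hd
      · rw [norm_sub_rev]; exact hc c hcN
      · exact h2 c hcN d hd hcd
  have := Nat.le_findGreatest (hb _ hQ) hQ
  omega

end Net

/-- If the quadratic form `‖T x‖² / m` is within `1/4` of `1` on a `1/4`-net of the unit sphere,
it is at least `1/2` on the sphere. -/
lemma half_le_of_net {E F : Type*} [NormedAddCommGroup E] [InnerProductSpace ℝ E]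
    [FiniteDimensional ℝ E] [NormedAddCommGroup F] [InnerProductSpace ℝ F]
    (T : E →ₗ[ℝ] F) (m : ℝ) (N : Set E) (hN : ∀ y ∈ N, ‖y‖ = 1)
    (hnet : ∀ x : E, ‖x‖ = 1 → ∃ y ∈ N, ‖x - y‖ ≤ 1 / 4)
    (hT : ∀ y ∈ N, |‖T y‖ ^ 2 - m| ≤ m / 4) (x : E) : m / 2 * ‖x‖ ^ 2 ≤ ‖T x‖ ^ 2 := by
  set q : E → ℝ := fun z => ‖T z‖ ^ 2 - m * ‖z‖ ^ 2 with hq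
  have hqs (c : ℝ) (z : E) : q (c • z) = c ^ 2 * q z := by
    simp only [hq, map_smul, norm_smul, mul_pow, Real.norm_eq_abs, sq_abs]; ring
  have hTc : Continuous T := T.continuous_of_finiteDimensional
  rcases subsingleton_or_nontrivial E with hE | hE
  · simp [Subsingleton.elim x 0]
  obtain ⟨x₀, hx₀, hmax⟩ := (isCompact_sphere (0 : E) 1).exists_isMaxOn
    (NormedSpace.sphere_nonempty.2 zero_le_one)
    (f := fun z => |q z|) (Continuous.continuousOn (by fun_prop))
  have hx₀1 : ‖x₀‖ = 1 := by simpa using hx₀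
  set M := |q x₀| with hM
  have hM0 : 0 ≤ M := abs_nonneg _
  have hbd (z : E) : |q z| ≤ M * ‖z‖ ^ 2 := by
    rcases eq_or_ne z 0 with rfl | hz
    · simp [hq]
    · have hz' : 0 < ‖z‖ := norm_pos_iff.2 hz
      have h1 : |q (‖z‖⁻¹ • z)| ≤ M := hmax (by simp [norm_smul, hz'.ne'])
      rw [hqs, abs_mul, abs_of_nonneg (by positivity), inv_pow, inv_mul_le_iff₀ (by positivity)] at h1
      linarith
  obtain ⟨y, hyN, hxy⟩ := hnet x₀ hx₀1
  have hy1 := hN y hyN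
  have hqy : |q y| ≤ m / 4 := by simpa [hq, hy1] using hT y hyN
  -- Polarization of `q x₀ - q y = B(x₀ + y, x₀ - y)`, `B` the bilinear form of `q`. The scaling by
  -- `8` balances `‖x₀ + y‖ ≤ 2` against `‖x₀ - y‖ ≤ 1/4`, so that the difference is at most `M/2`;
  -- then `M ≤ m/4 + M/2`.
  have hpol : q x₀ - q y =
      (q ((x₀ + y) + (8 : ℝ) • (x₀ - y)) - q ((x₀ + y) - (8 : ℝ) • (x₀ - y))) / 32 := by
    have e : ∀ z₁ z₂ : E, q (z₁ + z₂) - q (z₁ - z₂) =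
        4 * (inner ℝ (T z₁) (T z₂) - m * inner ℝ z₁ z₂) := by
      intro z₁ z₂
      simp only [hq, map_add, map_sub, norm_add_sq_real, norm_sub_sq_real]; ring
    rw [e]
    simp only [hq, map_smul, inner_smul_right, map_add, map_sub, inner_add_left, inner_sub_right,
      real_inner_self_eq_norm_sq, real_inner_comm x₀ y, real_inner_comm (T x₀) (T y)]
    ring
  have hpar : ‖(x₀ + y) + (8 : ℝ) • (x₀ - y)‖ ^ 2 + ‖(x₀ + y) - (8 : ℝ) • (x₀ - y)‖ ^ 2 ≤ 16 := by
    have h1 : ‖(x₀ + y) + (8 : ℝ) • (x₀ - y)‖ ^ 2 + ‖(x₀ + y) - (8 : ℝ) • (x₀ - y)‖ ^ 2 =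
        2 * ‖x₀ + y‖ ^ 2 + 128 * ‖x₀ - y‖ ^ 2 := by
      rw [norm_add_sq_real, norm_sub_sq_real (x₀ + y), norm_smul]; norm_num; ring
    have h2 : ‖x₀ + y‖ ^ 2 + ‖x₀ - y‖ ^ 2 = 4 := by
      rw [norm_add_sq_real, norm_sub_sq_real, hx₀1, hy1]; ring
    have h3 : ‖x₀ - y‖ ^ 2 ≤ (1 / 4) ^ 2 := by gcongr
    nlinarith
  have hM2 : M ≤ m / 2 := by
    have h1 : |q x₀ - q y| ≤ M / 2 := by
      rw [hpol]
      have := abs_sub (q ((x₀ + y) + (8 : ℝ) • (x₀ - y))) (q ((x₀ + y) - (8 : ℝ) • (x₀ - y)))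
      have b1 := hbd ((x₀ + y) + (8 : ℝ) • (x₀ - y))
      have b2 := hbd ((x₀ + y) - (8 : ℝ) • (x₀ - y))
      rw [abs_div, abs_of_pos (show (0 : ℝ) < 32 by norm_num)]
      nlinarith
    have h2 := abs_sub_abs_le_abs_sub (q x₀) (q y)
    linarith
  have h1 := (abs_le.1 (hbd x)).1
  have h2 : M * ‖x‖ ^ 2 ≤ m / 2 * ‖x‖ ^ 2 := by gcongr
  simp only [hq] at h1
  linarith

/-! ### Measurability of projections onto random subspaces -/

section Measurability

variable {E : Type*} [NormedAddCommGroup E] [InnerProductSpace ℝ E] [FiniteDimensional ℝ E]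

/-- Completing the square, the expression is `‖P y‖² - ‖P y - T u‖²`, with maximum at `T u = P y`.
Writing the projection norm as a supremum of continuous functions of the data makes it lower
semicontinuous, hence measurable, even where the rank of the span drops. -/
lemma isLUB_norm_sq_starProjection {G : Type*} [AddCommGroup G] [Module ℝ G] (T : G →ₗ[ℝ] E)
    (y : E) :
    IsLUB (Set.range fun u => 2 * inner ℝ (T u) y - ‖T u‖ ^ 2)
      (‖(LinearMap.range T).starProjection y‖ ^ 2) := by
  set P := (LinearMap.range T).starProjection
  have key (u : G) : 2 * inner ℝ (T u) y - ‖T u‖ ^ 2 = ‖P y‖ ^ 2 - ‖P y - T u‖ ^ 2 := by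
    have : inner ℝ (T u) y = inner ℝ (T u) (P y) := by
      rw [← Submodule.inner_starProjection_left_eq_right,
        Submodule.starProjection_eq_self_iff.2 (LinearMap.mem_range_self T u)]
    rw [this, norm_sub_sq_real, real_inner_comm]
    ring
  constructor
  · rintro _ ⟨u, rfl⟩
    simp only [key]
    linarith [sq_nonneg ‖P y - T u‖]
  · intro c hc
    obtain ⟨u, hu⟩ : P y ∈ LinearMap.range T := Submodule.starProjection_apply_mem _ _
    have := hc ⟨u, rfl⟩
    have h2 := key u
    simp only [hu, sub_self, norm_zero] at this h2
    linarith

lemma isLUB_norm_sq_starProjection_span {κ : Type*} [Fintype κ] (x : κ → E) (y : E) :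
    IsLUB (Set.range fun u : κ → ℝ => 2 * inner ℝ (∑ l, u l • x l) y - ‖∑ l, u l • x l‖ ^ 2)
      (‖(Submodule.span ℝ (Set.range x)).starProjection y‖ ^ 2) := by
  have h := isLUB_norm_sq_starProjection (Fintype.linearCombination ℝ x) y
  simp only [Fintype.linearCombination_apply] at h
  have h2 : LinearMap.range (Fintype.linearCombination ℝ x) = Submodule.span ℝ (Set.range x) :=
    Fintype.range_linearCombination ℝ x
  convert h using 5
  exact h2.symm

/-- The squared norm of the projection of a vector onto the span of `x` depends measurably on
the vector and `x`. -/
lemma measurable_norm_sq_starProjection_span {κ Ω : Type*} [Fintype κ] [MeasurableSpace Ω]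
    [MeasurableSpace E] [BorelSpace E]
    {x : Ω → κ → E} {y : Ω → E} (hx : Measurable x) (hy : Measurable y) :
    Measurable fun ω => ‖(Submodule.span ℝ (Set.range (x ω))).starProjection (y ω)‖ ^ 2 := by
  have h (a : (κ → E) × E) := isLUB_norm_sq_starProjection_span a.1 a.2
  have hc : Measurable fun a : (κ → E) × E => ⨆ u : κ → ℝ,
      (2 * inner ℝ (∑ l, u l • a.1 l) a.2 - ‖∑ l, u l • a.1 l‖ ^ 2) :=
    (lowerSemicontinuous_ciSup (fun a => (h a).bddAbove)
      (fun u => Continuous.lowerSemicontinuous (by fun_prop))).measurable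
  convert hc.comp (hx.prodMk hy) using 1
  ext ω
  exact (h (x ω, y ω)).ciSup_eq.symm

/-- Polarization, which transfers measurability from squared norms to inner products. -/
lemma inner_starProjection_eq (V : Submodule ℝ E) (x y : E) :
    inner ℝ (V.starProjection x) y =
      (‖V.starProjection (x + y)‖ ^ 2 - ‖V.starProjection (x - y)‖ ^ 2) / 4 := by
  have h : inner ℝ (V.starProjection x) y = inner ℝ (V.starProjection x) (V.starProjection y) := by
    rw [← Submodule.inner_starProjection_left_eq_right,
      Submodule.starProjection_eq_self_iff.2 (Submodule.starProjection_apply_mem _ _)]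
  rw [h, map_add, map_sub, norm_add_sq_real, norm_sub_sq_real]
  ring

lemma measurable_inner_starProjection_span {κ Ω : Type*} [Fintype κ] [MeasurableSpace Ω]
    [MeasurableSpace E] [BorelSpace E]
    {x : Ω → κ → E} {y z : Ω → E} (hx : Measurable x) (hy : Measurable y) (hz : Measurable z) :
    Measurable fun ω =>
      inner ℝ ((Submodule.span ℝ (Set.range (x ω))).starProjection (y ω)) (z ω) := by
  simp_rw [inner_starProjection_eq]
  exact ((measurable_norm_sq_starProjection_span hx (hy.add hz)).sub
    (measurable_norm_sq_starProjection_span hx (hy.sub hz))).div_const 4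

end Measurability

/-! ### Optimality conditions of the adaptive lasso -/

section KKT

variable {n p : ℕ}

/-- The `j`-th column of a design matrix. -/
noncomputable def col (X : Fin n → Fin p → ℝ) (j : Fin p) : EuclideanSpace ℝ (Fin n) :=
  WithLp.toLp 2 fun i => X i j

/-- The constant vector. -/
noncomputable def ones (n : ℕ) : EuclideanSpace ℝ (Fin n) := WithLp.toLp 2 fun _ => 1

/-- The vectors of mean zero. -/
noncomputable abbrev centeredSpace (n : ℕ) : Submodule ℝ (EuclideanSpace ℝ (Fin n)) :=
  (Submodule.span ℝ {ones n})ᗮ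

/-- The centred columns of a design matrix. -/
noncomputable def ccol (X : Fin n → Fin p → ℝ) (j : Fin p) : EuclideanSpace ℝ (Fin n) :=
  (centeredSpace n).starProjection (col X j)

/-- On feasible vectors the objective is real-valued; `toReal ∞ = 0` is harmless because the
corresponding coefficient vanishes. -/
lemma objective_eq_ofReal (X : Fin n → Fin p → ℝ) (Y : Fin n → ℝ) {lam : ℝ} (hlam : 0 < lam)
    (w : Fin p → ℝ≥0∞) (b0 : ℝ) (b : Fin p → ℝ) (hb : ∀ j, w j = ∞ → b j = 0) :
    objective X Y lam w b0 b = ENNReal.ofReal ((1 / 2) * ∑ i, (Y i - b0 - ∑ j, X i j * b j) ^ 2 +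
      lam * ∑ j, (w j).toReal * |b j|) := by
  have h0 : ∀ j, 0 ≤ (w j).toReal * |b j| := fun j => by positivity
  rw [objective, ENNReal.ofReal_add (by positivity)
    (mul_nonneg hlam.le (Finset.sum_nonneg fun j _ => h0 j)), ENNReal.ofReal_mul hlam.le,
    ENNReal.ofReal_sum_of_nonneg fun j _ => h0 j]
  congr 2
  refine Finset.sum_congr rfl fun j _ => ?_
  by_cases hj : w j = ∞
  · simp [hb j hj]
  · rw [ENNReal.ofReal_mul ENNReal.toReal_nonneg, ENNReal.ofReal_toReal hj]

variable {X : Fin n → Fin p → ℝ} {Y : Fin n → ℝ} {lam : ℝ} {w : Fin p → ℝ≥0∞} {b0 : ℝ}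
  {b : Fin p → ℝ}

/-- The zero vector has finite objective, so a minimizer cannot have an infinite one. -/
lemma IsAdaptiveLasso.eq_zero_of_weight_top (h : IsAdaptiveLasso X Y lam w b0 b) (hlam : 0 < lam)
    (j : Fin p) (hj : w j = ∞) : b j = 0 := by
  by_contra hb
  have h1 := h 0 0
  rw [objective_eq_ofReal X Y hlam w 0 0 (by simp)] at h1
  have h2 : objective X Y lam w b0 b = ∞ := by
    have h3 : w j * ENNReal.ofReal |b j| = ∞ := by
      rw [hj, ENNReal.top_mul]; simpa using hb
    have h4 : ∑ j, w j * ENNReal.ofReal |b j| = ∞ :=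
      ENNReal.sum_eq_top.2 ⟨j, Finset.mem_univ _, h3⟩
    rw [objective, h4, ENNReal.mul_top (by simpa using hlam), add_top]
  rw [h2, top_le_iff] at h1
  exact ENNReal.ofReal_ne_top h1

lemma IsAdaptiveLasso.real_le (h : IsAdaptiveLasso X Y lam w b0 b) (hlam : 0 < lam)
    (c0 : ℝ) (c : Fin p → ℝ) (hc : ∀ j, w j = ∞ → c j = 0) :
    (1 / 2) * ∑ i, (Y i - b0 - ∑ j, X i j * b j) ^ 2 + lam * ∑ j, (w j).toReal * |b j| ≤
    (1 / 2) * ∑ i, (Y i - c0 - ∑ j, X i j * c j) ^ 2 + lam * ∑ j, (w j).toReal * |c j| := by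
  have h1 := h c0 c
  rw [objective_eq_ofReal X Y hlam w c0 c hc,
    objective_eq_ofReal X Y hlam w b0 b (h.eq_zero_of_weight_top hlam)] at h1
  refine (ENNReal.ofReal_le_ofReal_iff ?_).1 h1
  have h0 : ∀ j, 0 ≤ (w j).toReal * |c j| := fun j => by positivity
  have := Finset.sum_nonneg fun j (_ : j ∈ Finset.univ) => h0 j
  positivity

/-- Stationarity without derivatives: near `t = 0` the linear term dominates and must vanish.
`nonneg_of_forall_small` is the one-sided version, needed because of the kink of `|·|`. -/
lemma eq_zero_of_quadratic {a c : ℝ} (h : ∀ t : ℝ, 0 ≤ -t * a + t ^ 2 * c) : a = 0 := by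
  have hc : 0 < 1 + |c| := by positivity
  have h1 := h (a / (1 + |c|))
  by_contra ha
  have ha2 : 0 < a ^ 2 := by positivity
  have h2 : -(a / (1 + |c|)) * a + (a / (1 + |c|)) ^ 2 * c = a ^ 2 * (c - 1 - |c|) / (1 + |c|) ^ 2 := by
    field_simp; ring
  rw [h2] at h1
  have h3 : a ^ 2 * (c - 1 - |c|) < 0 := mul_neg_of_pos_of_neg ha2 (by linarith [le_abs_self c])
  have := div_neg_of_neg_of_pos h3 (by positivity : 0 < (1 + |c|) ^ 2)
  linarith

lemma nonneg_of_forall_small {a c : ℝ} (h : ∀ t : ℝ, 0 < t → t < 1 → 0 ≤ t * a + t ^ 2 * c) :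
    0 ≤ a := by
  by_contra! ha
  have hc : 0 < 2 * (|a| + |c|) + 1 := by positivity
  have ht : |a| / (2 * (|a| + |c|) + 1) < 1 := by
    rw [div_lt_one hc]; linarith [abs_nonneg a, abs_nonneg c]
  have h1 := h (|a| / (2 * (|a| + |c|) + 1)) (div_pos (abs_pos.2 ha.ne) hc) ht
  set t := |a| / (2 * (|a| + |c|) + 1)
  have ht0 : 0 < t := div_pos (abs_pos.2 ha.ne) hc
  have h2 : 0 ≤ a + t * c := by
    have : t * a + t ^ 2 * c = t * (a + t * c) := by ring
    rw [this] at h1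
    exact nonneg_of_mul_nonneg_right h1 ht0
  have h3 : t * |c| < |a| := by
    rw [div_mul_eq_mul_div, div_lt_iff₀ hc]
    have := abs_pos.2 ha.ne
    nlinarith [abs_nonneg c]
  have h4 : t * c ≤ t * |c| := by gcongr; exact le_abs_self c
  rw [abs_of_neg ha] at h3
  linarith

/-- The residual of an adaptive lasso fit. -/
noncomputable def fitResidual (X : Fin n → Fin p → ℝ) (Y : Fin n → ℝ) (b0 : ℝ) (b : Fin p → ℝ) :
    EuclideanSpace ℝ (Fin n) :=
  WithLp.toLp 2 fun i => Y i - b0 - ∑ j, X i j * b j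

lemma IsAdaptiveLasso.inner_ones (h : IsAdaptiveLasso X Y lam w b0 b) (hlam : 0 < lam) :
    inner ℝ (ones n) (fitResidual X Y b0 b) = 0 := by
  apply eq_zero_of_quadratic (c := n / 2)
  intro t
  have h1 := h.real_le hlam (b0 + t) b (h.eq_zero_of_weight_top hlam)
  have h2 (i : Fin n) : (Y i - (b0 + t) - ∑ j, X i j * b j) ^ 2 =
      (Y i - b0 - ∑ j, X i j * b j) ^ 2 - 2 * t * (Y i - b0 - ∑ j, X i j * b j) + t ^ 2 := by ring
  simp_rw [h2, Finset.sum_add_distrib, Finset.sum_sub_distrib, ← Finset.mul_sum] at h1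
  simp only [PiLp.inner_apply, ones, fitResidual, Finset.sum_const, Finset.card_univ,
    Fintype.card_fin, nsmul_eq_mul, RCLike.inner_apply, conj_trivial, mul_one] at h1 ⊢
  linarith

/-- Comparison with the fit whose `j`-th coefficient is shifted by `t`, a feasible competitor since
`w j` is finite. Different choices of `t` yield both first-order conditions below. -/
lemma IsAdaptiveLasso.coordinate_le (h : IsAdaptiveLasso X Y lam w b0 b) (hlam : 0 < lam)
    (j : Fin p) (hj : w j ≠ ∞) (t : ℝ) :
    0 ≤ -t * inner ℝ (col X j) (fitResidual X Y b0 b) + t ^ 2 * (‖col X j‖ ^ 2 / 2) +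
      lam * (w j).toReal * (|b j + t| - |b j|) := by
  have h1 := h.real_le hlam b0 (Function.update b j (b j + t)) (by
    intro l hl
    rw [Function.update_of_ne (by rintro rfl; exact hj hl)]
    exact h.eq_zero_of_weight_top hlam l hl)
  have e1 (f : Fin p → ℝ → ℝ) : ∑ l, f l (Function.update b j (b j + t) l) =
      ∑ l, f l (b l) + (f j (b j + t) - f j (b j)) := by
    rw [← Finset.add_sum_erase _ _ (Finset.mem_univ j),
      ← Finset.add_sum_erase _ (fun l => f l (b l)) (Finset.mem_univ j), Function.update_self]
    have : ∀ l ∈ Finset.univ.erase j, f l (Function.update b j (b j + t) l) = f l (b l) := by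
      intro l hl
      rw [Function.update_of_ne (Finset.ne_of_mem_erase hl)]
    rw [Finset.sum_congr rfl this]
    ring
  rw [e1 fun l y => (w l).toReal * |y|] at h1
  simp_rw [fun i => e1 fun l y => X i l * y] at h1
  have h2 (i : Fin n) : (Y i - b0 - (∑ l, X i l * b l + (X i j * (b j + t) - X i j * b j))) ^ 2 =
      (Y i - b0 - ∑ l, X i l * b l) ^ 2 - 2 * t * ((Y i - b0 - ∑ l, X i l * b l) * X i j) +
        t ^ 2 * X i j ^ 2 := by ring
  simp_rw [h2, Finset.sum_add_distrib, Finset.sum_sub_distrib, ← Finset.mul_sum] at h1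
  simp only [PiLp.inner_apply, EuclideanSpace.real_norm_sq_eq, col, fitResidual,
    RCLike.inner_apply, conj_trivial]
  linarith

lemma IsAdaptiveLasso.abs_inner_le (h : IsAdaptiveLasso X Y lam w b0 b) (hlam : 0 < lam)
    (j : Fin p) (hj : w j ≠ ∞) :
    |inner ℝ (col X j) (fitResidual X Y b0 b)| ≤ lam * (w j).toReal := by
  set a := inner ℝ (col X j) (fitResidual X Y b0 b)
  have hw : 0 ≤ lam * (w j).toReal := by positivity
  have h1 (t : ℝ) : 0 ≤ -t * a + t ^ 2 * (‖col X j‖ ^ 2 / 2) + lam * (w j).toReal * |t| := by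
    have h2 := h.coordinate_le hlam j hj t
    have h3 : |b j + t| - |b j| ≤ |t| := by linarith [abs_add_le (b j) t]
    have := mul_le_mul_of_nonneg_left h3 hw
    linarith
  rw [abs_le]
  constructor
  · have := nonneg_of_forall_small (a := a + lam * (w j).toReal) (c := ‖col X j‖ ^ 2 / 2)
      (fun t ht _ => by have := h1 (-t); rw [abs_neg, abs_of_pos ht] at this; linarith)
    linarith
  · have := nonneg_of_forall_small (a := -a + lam * (w j).toReal) (c := ‖col X j‖ ^ 2 / 2)
      (fun t ht _ => by have := h1 t; rw [abs_of_pos ht] at this; linarith)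
    linarith

/-- Obtained by shrinking `b j` to `(1 - t) b j`, which saves exactly `t |b j|` in the penalty. It
expresses that the correlation has the sign of `b j` and full size. -/
lemma IsAdaptiveLasso.le_mul_inner (h : IsAdaptiveLasso X Y lam w b0 b) (hlam : 0 < lam)
    (j : Fin p) (hj : w j ≠ ∞) :
    lam * (w j).toReal * |b j| ≤ b j * inner ℝ (col X j) (fitResidual X Y b0 b) := by
  set a := inner ℝ (col X j) (fitResidual X Y b0 b)
  have := nonneg_of_forall_small (a := b j * a - lam * (w j).toReal * |b j|)
    (c := b j ^ 2 * (‖col X j‖ ^ 2 / 2)) (fun t ht ht1 => by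
      have h2 := h.coordinate_le hlam j hj (-t * b j)
      have h3 : |b j + -t * b j| = (1 - t) * |b j| := by
        rw [show b j + -t * b j = (1 - t) * b j by ring, abs_mul, abs_of_pos (by linarith)]
      rw [h3] at h2
      linarith)
  linarith

lemma IsAdaptiveLasso.starProjection_fitResidual (h : IsAdaptiveLasso X Y lam w b0 b)
    (hlam : 0 < lam) :
    (centeredSpace n).starProjection (fitResidual X Y b0 b) = fitResidual X Y b0 b := by
  rw [Submodule.starProjection_eq_self_iff, Submodule.mem_orthogonal_singleton_iff_inner_right]
  exact h.inner_ones hlam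

lemma starProjection_ones (n : ℕ) : (centeredSpace n).starProjection (ones n) = 0 := by
  rw [Submodule.starProjection_apply_eq_zero_iff, Submodule.orthogonal_orthogonal]
  exact Submodule.mem_span_singleton_self _

lemma fitResidual_response (S : Finset (Fin p)) (β0 : ℝ) (β : Fin p → ℝ) (e : Fin n → ℝ) :
    fitResidual X (response S β0 β X e) b0 b = WithLp.toLp 2 e + (β0 - b0) • ones n +
      ∑ j ∈ S, (β j - b j) • col X j - ∑ j ∈ Sᶜ, b j • col X j := by
  ext i
  simp only [fitResidual, response, ones, col, PiLp.add_apply, PiLp.sub_apply, PiLp.smul_apply,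
    WithLp.ofLp_sum, Finset.sum_apply, smul_eq_mul, WithLp.ofLp_smul, Pi.smul_apply]
  rw [← Finset.sum_add_sum_compl S (fun j => X i j * b j)]
  simp_rw [sub_mul, Finset.sum_sub_distrib, mul_comm (b _), mul_comm (β _)]
  ring

/-- The first-order conditions of the adaptive lasso in terms of centred variables. -/
lemma IsAdaptiveLasso.kkt {S : Finset (Fin p)} {β0 : ℝ} {β : Fin p → ℝ} {e : Fin n → ℝ}
    (h : IsAdaptiveLasso X (response S β0 β X e) lam w b0 b) (hlam : 0 < lam) :
    ∃ r : EuclideanSpace ℝ (Fin n),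
      r = (centeredSpace n).starProjection (WithLp.toLp 2 e) +
        ∑ j ∈ S, (β j - b j) • ccol X j - ∑ j ∈ Sᶜ, b j • ccol X j ∧
      ∀ j, w j ≠ ∞ → |inner ℝ (ccol X j) r| ≤ lam * (w j).toReal ∧
        lam * (w j).toReal * |b j| ≤ b j * inner ℝ (ccol X j) r := by
  have h1 := h.starProjection_fitResidual hlam
  -- The residual is its own centring, as the intercept is unpenalized; centring its expansion then
  -- eliminates both intercepts.
  refine ⟨fitResidual X (response S β0 β X e) b0 b, ?_, fun j hj => ?_⟩
  · rw [← h1, fitResidual_response]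
    simp only [map_sub, map_add, map_smul, map_sum, starProjection_ones, smul_zero, add_zero, ccol]
  · have h2 : inner ℝ (ccol X j) (fitResidual X (response S β0 β X e) b0 b) =
        inner ℝ (col X j) (fitResidual X (response S β0 β X e) b0 b) := by
      rw [ccol, Submodule.inner_starProjection_left_eq_right, h1]
    rw [h2]
    exact ⟨h.abs_inner_le hlam j hj, h.le_mul_inner hlam j hj⟩

end KKT

/-! ### Deterministic support recovery -/

section Deterministic

variable {E : Type*} [NormedAddCommGroup E] [InnerProductSpace ℝ E] [FiniteDimensional ℝ E]

/-- Strict dual feasibility excludes false positives of every stationary point. -/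
lemma eq_zero_of_dual_feasible {ι : Type*} [Fintype ι] [DecidableEq ι] (S : Finset ι) (x : ι → E)
    (V : Submodule ℝ E) (hV : ∀ j ∈ S, x j ∈ V) (e r : E) (d b τ : ι → ℝ)
    (hr : r = e + ∑ j ∈ S, d j • x j - ∑ j ∈ Sᶜ, b j • x j)
    (h1 : ∀ j ∉ S, b j ≠ 0 → τ j * |b j| ≤ b j * inner ℝ (x j) r)
    (h2 : ∀ j ∉ S, b j ≠ 0 →
      |inner ℝ (x j) (V.starProjection r)| + |inner ℝ (x j - V.starProjection (x j)) e| < τ j) :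
    ∀ j ∉ S, b j = 0 := by
  set P := V.starProjection
  set z := ∑ j ∈ Sᶜ, b j • x j with hz
  have hPd : P (∑ j ∈ S, d j • x j) = ∑ j ∈ S, d j • x j :=
    Submodule.starProjection_eq_self_iff.2 (V.sum_mem fun j hj => V.smul_mem _ (hV j hj))
  have hrP : r - P r = (e - P e) - (z - P z) := by
    rw [hr, map_sub, map_add, hPd]; abel
  have hsa (u v : E) : inner ℝ u (v - P v) = inner ℝ (u - P u) v := by
    rw [inner_sub_right, inner_sub_left, Submodule.inner_starProjection_left_eq_right]
  have hPP (u : E) : P (P u) = P u :=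
    Submodule.starProjection_eq_self_iff.2 (Submodule.starProjection_apply_mem _ _)
  -- The part of `r` orthogonal to `V` involves only the noise and `z` itself; the latter
  -- contributes a negative square, which can be dropped.
  have hzr : inner ℝ z r = inner ℝ z (P r) + inner ℝ (z - P z) e - ‖z - P z‖ ^ 2 := by
    have h3 : r = P r + (r - P r) := by abel
    have h4 : inner ℝ z (z - P z) = ‖z - P z‖ ^ 2 := by
      rw [← real_inner_self_eq_norm_sq, hsa (z - P z) z, map_sub, hPP, sub_self, sub_zero,
        real_inner_comm]
    conv_lhs => rw [h3, hrP]
    rw [inner_add_right, inner_sub_right, h4, hsa]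
    ring
  have hle : ∑ j ∈ Sᶜ, τ j * |b j| ≤ ∑ j ∈ Sᶜ,
      |b j| * (|inner ℝ (x j) (P r)| + |inner ℝ (x j - P (x j)) e|) := by
    calc ∑ j ∈ Sᶜ, τ j * |b j| ≤ ∑ j ∈ Sᶜ, b j * inner ℝ (x j) r := by
          refine Finset.sum_le_sum fun j hj => ?_
          by_cases hb : b j = 0
          · simp [hb]
          · exact h1 j (Finset.mem_compl.1 hj) hb
      _ = inner ℝ z r := by simp [hz, sum_inner, inner_smul_left]
      _ ≤ inner ℝ z (P r) + inner ℝ (z - P z) e := by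
          rw [hzr]; linarith [sq_nonneg ‖z - P z‖]
      _ = ∑ j ∈ Sᶜ, b j * (inner ℝ (x j) (P r) + inner ℝ (x j - P (x j)) e) := by
          simp only [hz, map_sum, map_smul, ← Finset.sum_sub_distrib, ← smul_sub, sum_inner,
            inner_smul_left, mul_add, Finset.sum_add_distrib, conj_trivial]
      _ ≤ _ := by
          refine Finset.sum_le_sum fun j _ => (le_abs_self _).trans ?_
          rw [abs_mul]
          gcongr
          exact abs_add_le _ _
  intro j hj
  by_contra hb
  refine absurd hle (not_le.2 (Finset.sum_lt_sum (fun i hi => ?_)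
    ⟨j, Finset.mem_compl.2 hj, ?_⟩))
  · by_cases hbi : b i = 0
    · simp [hbi]
    · rw [mul_comm (τ i)]
      exact mul_le_mul_of_nonneg_left (h2 i (Finset.mem_compl.1 hi) hbi).le (abs_nonneg _)
  · rw [mul_comm (τ j)]
    exact mul_lt_mul_of_pos_left (h2 j hj hb) (abs_pos.2 hb)

variable {κ : Type*} [Fintype κ] {x : κ → E} {k : ℝ} {r : E} {A : ℝ}

omit [FiniteDimensional ℝ E] in
-- Cauchy–Schwarz against the vector of correlations `⟨x_l, r⟩`, whose norm is at most `√(card κ)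
-- A`.
lemma abs_inner_sum_smul_le (hA : ∀ l, |inner ℝ (x l) r| ≤ A) (u : EuclideanSpace ℝ κ) :
    |inner ℝ (∑ l, u l • x l) r| ≤ ‖u‖ * (√(Fintype.card κ) * A) := by
  let a : EuclideanSpace ℝ κ := WithLp.toLp 2 fun l => inner ℝ (x l) r
  have h1 : inner ℝ (∑ l, u l • x l) r = inner ℝ a u := by
    simp [sum_inner, inner_smul_left, PiLp.inner_apply, a]
  have h2 : ‖a‖ ≤ √(Fintype.card κ) * A := by
    rcases isEmpty_or_nonempty κ with hκ | ⟨⟨l⟩⟩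
    · simp [Subsingleton.elim a 0]
    have hA0 : 0 ≤ A := (abs_nonneg _).trans (hA l)
    rw [EuclideanSpace.norm_eq]
    calc √(∑ l, ‖a l‖ ^ 2) ≤ √(∑ _l : κ, A ^ 2) := by
          gcongr with l
          exact hA l
      _ = √(Fintype.card κ) * A := by
          rw [Finset.sum_const, nsmul_eq_mul, Finset.card_univ, Real.sqrt_mul (by positivity),
            Real.sqrt_sq hA0]
  rw [h1]
  calc _ ≤ ‖a‖ * ‖u‖ := abs_real_inner_le_norm _ _
    _ ≤ _ := by rw [mul_comm]; gcongr

lemma starProjection_span_eq_sum (y : E) :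
    ∃ θ : EuclideanSpace ℝ κ, (Submodule.span ℝ (Set.range x)).starProjection y =
      ∑ l, θ l • x l := by
  obtain ⟨c, hc⟩ := (Submodule.mem_span_range_iff_exists_fun ℝ).1
    (Submodule.starProjection_apply_mem (Submodule.span ℝ (Set.range x)) y)
  exact ⟨WithLp.toLp 2 c, hc.symm⟩

/-- Bound on the correlation of an inactive feature `∑ Γₗ xₗ + ε` with the fitted part of the
residual. -/
lemma abs_inner_starProjection_le (hk : 0 < k)
    (hlow : ∀ u : EuclideanSpace ℝ κ, k ^ 2 * ‖u‖ ^ 2 ≤ ‖∑ l, u l • x l‖ ^ 2)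
    (hA0 : 0 ≤ A) (hA : ∀ l, |inner ℝ (x l) r| ≤ A) (Γ : EuclideanSpace ℝ κ) (ε : E) {G Q : ℝ}
    (hΓ : ‖Γ‖ ≤ G) (hQ : ‖(Submodule.span ℝ (Set.range x)).starProjection ε‖ ≤ Q) :
    |inner ℝ (∑ l, Γ l • x l + ε) ((Submodule.span ℝ (Set.range x)).starProjection r)| ≤
      √(Fintype.card κ) * A * (G + Q / k) := by
  set V := Submodule.span ℝ (Set.range x)
  obtain ⟨θ, hθ⟩ := starProjection_span_eq_sum (x := x) ε
  have hθn : ‖θ‖ ≤ Q / k := by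
    rw [le_div_iff₀ hk]
    refine le_trans ?_ hQ
    refine abs_le_of_sq_le_sq' ?_ (norm_nonneg _) |>.2
    rw [hθ, mul_pow, mul_comm]
    exact hlow θ
  have hΓV : V.starProjection (∑ l, Γ l • x l) = ∑ l, Γ l • x l :=
    Submodule.starProjection_eq_self_iff.2 (V.sum_mem fun l _ =>
      V.smul_mem _ (Submodule.subset_span ⟨l, rfl⟩))
  -- Moving the projection onto the feature expresses everything through correlations of core
  -- columns with `r`, which stationarity bounds.
  have h1 : inner ℝ (∑ l, Γ l • x l + ε) (V.starProjection r) =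
      inner ℝ (∑ l, (Γ + θ) l • x l) r := by
    rw [← Submodule.inner_starProjection_left_eq_right, map_add, hΓV, hθ]
    simp [add_smul, Finset.sum_add_distrib]
  rw [h1]
  refine (abs_inner_sum_smul_le hA _).trans ?_
  rw [mul_comm]
  gcongr
  exact (norm_add_le _ _).trans (add_le_add hΓ hθn)

/-- Bound on the estimation error of a stationary point supported on the core set. -/
lemma norm_error_le (hk : 0 < k)
    (hlow : ∀ u : EuclideanSpace ℝ κ, k ^ 2 * ‖u‖ ^ 2 ≤ ‖∑ l, u l • x l‖ ^ 2)
    (hA : ∀ l, |inner ℝ (x l) r| ≤ A) (Δ : EuclideanSpace ℝ κ) (e : E)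
    (hr : r = e + ∑ l, Δ l • x l) :
    ‖Δ‖ ≤ ‖(Submodule.span ℝ (Set.range x)).starProjection e‖ / k +
      √(Fintype.card κ) * A / k ^ 2 := by
  set V := Submodule.span ℝ (Set.range x)
  set t := ∑ l, Δ l • x l with ht
  have htV : V.starProjection t = t :=
    Submodule.starProjection_eq_self_iff.2 (V.sum_mem fun l _ =>
      V.smul_mem _ (Submodule.subset_span ⟨l, rfl⟩))
  -- Testing `r = e + t` against `t` gives `‖t‖² ≤ ‖Δ‖ B + ‖t‖ Z`, with `B`, `Z` as named below.
  -- Using `k ‖Δ‖ ≤ ‖t‖` twice turns this into a linear bound on `‖Δ‖`.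
  have h1 : ‖t‖ ^ 2 = inner ℝ t r - inner ℝ t (V.starProjection e) := by
    rw [← Submodule.inner_starProjection_left_eq_right, htV, hr, inner_add_right,
      real_inner_self_eq_norm_sq]
    ring
  have h2 := (abs_le.1 (abs_inner_sum_smul_le hA Δ)).2
  have h3 := (abs_le.1 (abs_real_inner_le_norm t (V.starProjection e))).1
  have h4 : k * ‖Δ‖ ≤ ‖t‖ := by
    refine abs_le_of_sq_le_sq' ?_ (norm_nonneg _) |>.2
    rw [mul_pow]
    exact hlow Δ
  set B := √(Fintype.card κ) * A
  set Z := ‖V.starProjection e‖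
  rcases eq_or_lt_of_le (norm_nonneg Δ) with h0 | h0
  · rw [← h0] at h2 h4 ⊢
    have hB : 0 ≤ B := by
      rcases isEmpty_or_nonempty κ with hκ | ⟨⟨l⟩⟩
      · simp [B]
      · exact mul_nonneg (Real.sqrt_nonneg _) ((abs_nonneg _).trans (hA l))
    positivity
  · have h5 : ‖t‖ ^ 2 ≤ ‖Δ‖ * B + ‖t‖ * Z := by rw [h1]; linarith
    have ht0 : 0 < ‖t‖ := (by positivity : 0 < k * ‖Δ‖).trans_le h4
    have hB : 0 ≤ B := by
      rcases isEmpty_or_nonempty κ with hκ | ⟨⟨l⟩⟩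
      · simp [B]
      · exact mul_nonneg (Real.sqrt_nonneg _) ((abs_nonneg _).trans (hA l))
    have h6 : ‖t‖ * (k * ‖t‖) ≤ ‖t‖ * (B + k * Z) := by nlinarith
    have h7 := le_of_mul_le_mul_left h6 ht0
    have h8 : k ^ 2 * ‖Δ‖ ≤ B + k * Z := by nlinarith
    have h9 : Z / k + B / k ^ 2 = (B + k * Z) / k ^ 2 := by field_simp; ring
    rw [h9, le_div_iff₀ (by positivity)]
    linarith

end Deterministic

/-! ### Quadratic forms -/

/-- Subtracting `c` times the identity shifts the spectrum by `c`, so the difference is positive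
semidefinite. -/
lemma le_quadForm_of_spectrum {κ : Type*} [Fintype κ] [DecidableEq κ] {M : Matrix κ κ ℝ}
    (hM : M.PosSemidef) {c : ℝ} (hc : ∀ μ ∈ spectrum ℝ M, c ≤ μ) (u : EuclideanSpace ℝ κ) :
    c * ‖u‖ ^ 2 ≤ u.ofLp ⬝ᵥ M.mulVec u.ofLp := by
  have h1 : (M - algebraMap ℝ (Matrix κ κ ℝ) c).PosSemidef := by
    refine Matrix.posSemidef_iff_isHermitian_and_spectrum_nonneg.2 ⟨?_, ?_⟩
    · refine hM.isHermitian.sub ?_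
      rw [Matrix.IsHermitian, Matrix.algebraMap_eq_diagonal, Matrix.diagonal_conjTranspose]
      congr 1
    · rw [← spectrum.sub_singleton_eq]
      rintro _ ⟨a, ha, _, rfl, rfl⟩
      exact sub_nonneg.2 (hc a ha)
  have h2 := h1.dotProduct_mulVec_nonneg u.ofLp
  rw [Matrix.sub_mulVec, dotProduct_sub, Algebra.algebraMap_eq_smul_one, Matrix.smul_mulVec,
    Matrix.one_mulVec, dotProduct_smul] at h2
  have h3 : ‖u‖ ^ 2 = u.ofLp ⬝ᵥ u.ofLp := by
    rw [EuclideanSpace.real_norm_sq_eq]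
    simp [dotProduct, sq]
  rw [h3]
  simpa using h2

/-- A positive definite quadratic form is the squared norm in other coordinates. -/
lemma exists_whitening {κ : Type*} [Fintype κ] [DecidableEq κ] {M : Matrix κ κ ℝ}
    (hM : M.PosSemidef) {c : ℝ} (hc : 0 < c)
    (hMc : ∀ u : EuclideanSpace ℝ κ, c * ‖u‖ ^ 2 ≤ u.ofLp ⬝ᵥ M.mulVec u.ofLp) :
    ∃ B : EuclideanSpace ℝ κ ≃ₗ[ℝ] EuclideanSpace ℝ κ,
      ∀ u, ‖B u‖ ^ 2 = u.ofLp ⬝ᵥ M.mulVec u.ofLp := by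
  obtain ⟨A, hA⟩ : ∃ A : Matrix κ κ ℝ, M = A.conjTranspose * A := by
    open scoped MatrixOrder in
    exact CStarAlgebra.nonneg_iff_eq_star_mul_self.1 hM.nonneg
  have hn (u : EuclideanSpace ℝ κ) :
      ‖A.toEuclideanLin u‖ ^ 2 = u.ofLp ⬝ᵥ M.mulVec u.ofLp := by
    rw [hA, ← Matrix.mulVec_mulVec, Matrix.dotProduct_mulVec, EuclideanSpace.real_norm_sq_eq,
      Matrix.vecMul_conjTranspose]
    simp [dotProduct, sq, Matrix.toLpLin_apply]
  have hinj : Function.Injective A.toEuclideanLin := by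
    rw [injective_iff_map_eq_zero]
    intro u hu
    have h1 := hMc u
    rw [← hn, hu, norm_zero] at h1
    have h2 : ‖u‖ ^ 2 ≤ 0 := by
      by_contra! h
      nlinarith
    exact norm_eq_zero.1 (pow_eq_zero_iff two_ne_zero |>.1 (le_antisymm h2 (sq_nonneg _)))
  exact ⟨LinearEquiv.ofInjectiveEndo _ hinj, hn⟩

/-! ### Laws of the rows and columns of a hub design -/

section Laws

/-- A bound for a bad event of a pair with product law from bounds for its sections. -/
lemma measure_le_of_hasLaw_prod {Ω α γ : Type*} [MeasurableSpace Ω] [MeasurableSpace α]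
    [MeasurableSpace γ] {P : Measure Ω} {μ : Measure α} {ν : Measure γ} [IsProbabilityMeasure μ]
    [IsProbabilityMeasure ν] {Y : Ω → α} {Z : Ω → γ}
    (h : HasLaw (fun ω => (Y ω, Z ω)) (μ.prod ν) P) (q : α → γ → Prop)
    (hq : MeasurableSet {c : α × γ | q c.1 c.2})
    {δ : ℝ} (hδ : ∀ a, ν.real {c | q a c} ≤ δ) :
    P {ω | q (Y ω) (Z ω)} ≤ ENNReal.ofReal δ := by
  rw [h.measure_eq (p := fun x => q x.1 x.2) hq, Measure.prod_apply hq]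
  calc ∫⁻ a, ν (Prod.mk a ⁻¹' {c : α × γ | q c.1 c.2}) ∂μ ≤ ∫⁻ _a, ENNReal.ofReal δ ∂μ := by
        refine lintegral_mono fun a => ?_
        rw [← ofReal_measureReal]
        exact ENNReal.ofReal_le_ofReal (hδ a)
    _ = ENNReal.ofReal δ := by simp

lemma measure_le_of_hasLaw {Ω α : Type*} [MeasurableSpace Ω] [MeasurableSpace α]
    {P : Measure Ω} {μ : Measure α} [IsProbabilityMeasure μ] {Y : Ω → α} (h : HasLaw Y μ P)
    {B : Set α} (hB : MeasurableSet B) {δ : ℝ} (hδ : μ.real B ≤ δ) :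
    P {ω | Y ω ∈ B} ≤ ENNReal.ofReal δ := by
  rw [h.measure_eq (p := fun x => x ∈ B) hB, Set.ofPred_mem_eq, ← ofReal_measureReal]
  exact ENNReal.ofReal_le_ofReal hδ

variable {Ω : Type*} [MeasurableSpace Ω] {P : Measure Ω} {n p : ℕ}

lemma hasLaw_gaussVec {v : ℝ≥0} {e : Ω → Fin n → ℝ} (hi : iIndepFun (fun i ω => e ω i) P)
    (he : ∀ i, HasLaw (fun ω => e ω i) (gaussianReal 0 v) P) :
    HasLaw (fun ω => WithLp.toLp 2 (e ω)) (gaussVec n v) P :=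
  HasLaw.comp (Y := WithLp.toLp 2) ⟨by fun_prop, rfl⟩ (hi.hasLaw_pi he)

variable {X : Ω → Fin n → Fin p → ℝ} {Sig : Matrix (Fin p) (Fin p) ℝ} {S : Finset (Fin p)}

lemma IsHubDesign.aemeasurable_row (hX : IsHubDesign P X Sig S) (i : Fin n) :
    AEMeasurable (fun ω => X ω i) P :=
  (by fun_prop : Measurable (WithLp.ofLp : EuclideanSpace ℝ (Fin p) → Fin p → ℝ)).comp_aemeasurable
    (hX.law_rows i).aemeasurable

lemma IsHubDesign.aemeasurable (hX : IsHubDesign P X Sig S) : AEMeasurable X P :=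
  aemeasurable_pi_lambda _ hX.aemeasurable_row

/-- The functional is the inner product with `∑ u_l e_{f l}`, and its variance is the covariance
form there. A general index map `f` covers both the core block and a single column. -/
lemma hasLaw_linear_multivariateGaussian (hS : Sig.PosSemidef) {κ : Type*} [Fintype κ]
    (f : κ → Fin p) (u : κ → ℝ) :
    HasLaw (fun x : EuclideanSpace ℝ (Fin p) => ∑ l, u l * x (f l))
      (gaussianReal 0 (u ⬝ᵥ (Sig.submatrix f f).mulVec u).toNNReal) (multivariateGaussian 0 Sig) := by
  classical
  refine ⟨by fun_prop, ?_⟩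
  set c : EuclideanSpace ℝ (Fin p) := ∑ l, u l • EuclideanSpace.single (f l) (1 : ℝ) with hc
  have h1 : (fun x : EuclideanSpace ℝ (Fin p) => ∑ l, u l * x (f l)) = innerSL ℝ c := by
    ext x
    simp [hc, EuclideanSpace.inner_single_left]
  have hL : MemLp id 2 (multivariateGaussian 0 Sig) := IsGaussian.memLp_two_id
  rw [h1, IsGaussian.map_eq_gaussianReal]
  congr 1
  · rw [ContinuousLinearMap.integral_comp_id_comm IsGaussian.integrable_id]
    simp
  · congr 1
    have h2 := covarianceBilin_self hL c
    have h3 : Var[innerSL ℝ c; multivariateGaussian 0 Sig] =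
        covarianceBilin (multivariateGaussian 0 Sig) c c := h2.symm
    rw [h3, hc]
    simp only [map_sum, map_smul, sum_apply, smul_apply,
      covarianceBilin_multivariateGaussian hS, smul_eq_mul]
    simp [dotProduct, Matrix.mulVec, Finset.mul_sum]
    rw [Finset.sum_comm]
    exact Finset.sum_congr rfl fun i _ => Finset.sum_congr rfl fun l _ => by ring

lemma IsHubDesign.hasLaw_row_linear (hX : IsHubDesign P X Sig S) {κ : Type*} [Fintype κ]
    (f : κ → Fin p) (u : κ → ℝ) (i : Fin n) :
    HasLaw (fun ω => ∑ l, u l * X ω i (f l))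
      (gaussianReal 0 (u ⬝ᵥ (Sig.submatrix f f).mulVec u).toNNReal) P :=
  (hasLaw_linear_multivariateGaussian hX.posSemidef f u).comp (hX.law_rows i)

lemma IsHubDesign.hasLaw_linear (hX : IsHubDesign P X Sig S) {κ : Type*} [Fintype κ]
    (f : κ → Fin p) (u : κ → ℝ) :
    HasLaw (fun ω => ∑ l, u l • col (X ω) (f l))
      (gaussVec n (u ⬝ᵥ (Sig.submatrix f f).mulVec u).toNNReal) P := by
  have h1 : iIndepFun (fun i ω => ∑ l, u l * X ω i (f l)) P :=
    hX.indep_rows.comp (fun _ x => ∑ l, u l * x (f l)) (fun _ => by fun_prop)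
  convert hasLaw_gaussVec h1 (hX.hasLaw_row_linear f u) using 1
  ext ω i
  simp [col]

lemma IsHubDesign.hasLaw_col (hX : IsHubDesign P X Sig S) (j : Fin p) :
    HasLaw (fun ω => col (X ω) j) (gaussVec n 1) P := by
  convert hX.hasLaw_linear (fun _ : Unit => j) (fun _ => 1) using 1
  · simp
  · simp [dotProduct, Matrix.mulVec, hX.diag_eq_one]

/-- The core features and one error variable of a hub design are independent. -/
lemma IsHubDesign.hasLaw_core_residual [IsProbabilityMeasure P] (hX : IsHubDesign P X Sig S)
    {Γ : S → {j // j ∉ S} → ℝ} (j : {j // j ∉ S}) {v : ℝ≥0}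
    (hv : ∀ i, HasLaw (fun ω => residual S Γ (X ω i) j) (gaussianReal 0 v) P)
    (hi : ∀ i, IndepFun (fun ω (l : S) => X ω i l.1) (fun ω => residual S Γ (X ω i)) P) :
    ∃ μ : Measure (Fin n → S → ℝ), IsProbabilityMeasure μ ∧
      HasLaw (fun ω => ((fun i (l : S) => X ω i l.1),
        (WithLp.toLp 2 fun i => residual S Γ (X ω i) j : EuclideanSpace ℝ (Fin n))))
        (μ.prod (gaussVec n v)) P := by
  have hm (i : Fin n) : AEMeasurable (fun ω (l : S) => X ω i l.1) P :=
    (by fun_prop : Measurable fun (x : Fin p → ℝ) (l : S) => x l.1).comp_aemeasurable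
      (hX.aemeasurable_row i)
  let μ (i : Fin n) : Measure (S → ℝ) := P.map (fun ω (l : S) => X ω i l.1)
  have hμ (i : Fin n) : IsProbabilityMeasure (μ i) := Measure.isProbabilityMeasure_map (hm i)
  have h1 (i : Fin n) : HasLaw (fun ω => ((fun (l : S) => X ω i l.1), residual S Γ (X ω i) j))
      ((μ i).prod (gaussianReal 0 v)) P :=
    IndepFun.hasLaw_prod ⟨hm i, rfl⟩ (hv i) ((hi i).comp measurable_id (measurable_pi_apply j))
  have h2 : iIndepFun (fun i ω => ((fun (l : S) => X ω i l.1), residual S Γ (X ω i) j)) P :=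
    hX.indep_rows.comp (fun _ x => ((fun (l : S) => x l.1), residual S Γ x j))
      (fun _ => by unfold residual; fun_prop)
  refine ⟨Measure.pi μ, inferInstance, ?_⟩
  -- Independence within each row and across rows makes the rows a product of products; regrouping
  -- turns a vector of pairs into a pair of independent vectors.
  have h3 := (measurePreserving_arrowProdEquivProdArrow (S → ℝ) ℝ (Fin n) μ
    (fun _ => gaussianReal 0 v)).hasLaw.comp (h2.hasLaw_pi h1)
  have h4 : MeasurePreserving (Prod.map id (WithLp.toLp 2 : (Fin n → ℝ) → EuclideanSpace ℝ (Fin n)))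
      ((Measure.pi μ).prod (Measure.pi fun _ => gaussianReal 0 v))
      ((Measure.pi μ).prod (gaussVec n v)) :=
    (MeasurePreserving.id _).prod ⟨by fun_prop, rfl⟩
  exact h4.hasLaw.comp h3

/-- The coefficients of the core features and the error variance are bounded, as features have
unit variance. -/
lemma IsHubDesign.variance_decomposition [IsProbabilityMeasure P] (hX : IsHubDesign P X Sig S)
    {Γ : S → {j // j ∉ S} → ℝ} (j : {j // j ∉ S}) {v : ℝ≥0} (i : Fin n)
    (hv : HasLaw (fun ω => residual S Γ (X ω i) j) (gaussianReal 0 v) P)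
    (hi : IndepFun (fun ω (l : S) => X ω i l.1) (fun ω => residual S Γ (X ω i)) P) :
    (fun l => Γ l j) ⬝ᵥ (Sig.submatrix (Subtype.val : S → Fin p) Subtype.val).mulVec
      (fun l => Γ l j) + v = 1 := by
  have hpos : 0 ≤ (fun l => Γ l j) ⬝ᵥ (Sig.submatrix (Subtype.val : S → Fin p) Subtype.val).mulVec
      (fun l => Γ l j) := by
    simpa using (hX.posSemidef.submatrix (Subtype.val : S → Fin p)).dotProduct_mulVec_nonneg
      (fun l => Γ l j)
  have h1 := hX.hasLaw_row_linear (Subtype.val : S → Fin p) (fun l => Γ l j) i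
  have h2 : HasLaw (fun ω => X ω i j) (gaussianReal 0 1) P := by
    convert hX.hasLaw_row_linear (fun _ : Unit => j.1) (fun _ => 1) i using 1
    · simp
    · simp [dotProduct, Matrix.mulVec, hX.diag_eq_one]
  have hL {Y : Ω → ℝ} {a : ℝ≥0} (h : HasLaw Y (gaussianReal 0 a) P) : MemLp Y 2 P := by
    have := memLp_id_gaussianReal' (μ := 0) (v := a) 2 (by simp)
    rw [← h.map_eq] at this
    exact (memLp_map_measure_iff this.1 h.aemeasurable).1 this
  have h3 : IndepFun (fun ω => ∑ l : S, Γ l j * X ω i l) (fun ω => residual S Γ (X ω i) j) P :=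
    hi.comp (φ := fun x : S → ℝ => ∑ l, Γ l j * x l)
      (ψ := fun y : {j // j ∉ S} → ℝ => y j) (by fun_prop) (measurable_pi_apply j)
  have h4 := h3.variance_add (hL h1) (hL hv)
  have h5 : (fun ω => ∑ l : S, Γ l j * X ω i l) + (fun ω => residual S Γ (X ω i) j) =
      fun ω => X ω i j := by
    ext ω
    simp [residual, mul_comm]
  rw [h5, h2.variance_eq, h1.variance_eq, hv.variance_eq, variance_id_gaussianReal,
    variance_id_gaussianReal, variance_id_gaussianReal, Real.coe_toNNReal _ hpos] at h4
  simpa using h4.symm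

end Laws

/-! ### High-probability events of a hub design -/

section Events

variable {n p : ℕ}

/-- The span of the centred core columns. -/
noncomputable def coreSpan (S : Finset (Fin p)) (X : Fin n → Fin p → ℝ) :
    Submodule ℝ (EuclideanSpace ℝ (Fin n)) :=
  Submodule.span ℝ (Set.range fun l : S => ccol X l)

lemma ccol_mem_coreSpan {S : Finset (Fin p)} (X : Fin n → Fin p → ℝ) {j : Fin p} (hj : j ∈ S) :
    ccol X j ∈ coreSpan S X :=
  Submodule.subset_span ⟨⟨j, hj⟩, rfl⟩

lemma coreSpan_le (S : Finset (Fin p)) (X : Fin n → Fin p → ℝ) :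
    coreSpan S X ≤ centeredSpace n := by
  refine Submodule.span_le.2 ?_
  rintro _ ⟨l, rfl⟩
  exact Submodule.starProjection_apply_mem _ _

lemma finrank_coreSpan_le (S : Finset (Fin p)) (X : Fin n → Fin p → ℝ) :
    Module.finrank ℝ (coreSpan S X) ≤ S.card := by
  have h := finrank_range_le_card (R := ℝ) fun l : S => ccol X l
  rw [Fintype.card_coe] at h
  exact h

lemma starProjection_coreSpan_centered (S : Finset (Fin p)) (X : Fin n → Fin p → ℝ)
    (y : EuclideanSpace ℝ (Fin n)) :
    (coreSpan S X).starProjection ((centeredSpace n).starProjection y) =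
      (coreSpan S X).starProjection y := by
  have h := Submodule.starProjection_comp_starProjection_of_le (coreSpan_le S X)
  exact DFunLike.congr_fun h y

lemma measurable_ccol (j : Fin p) : Measurable fun X : Fin n → Fin p → ℝ => ccol X j := by
  unfold ccol col
  fun_prop

lemma measurable_ccol_core (S : Finset (Fin p)) :
    Measurable fun (X : Fin n → Fin p → ℝ) (l : S) => ccol X l :=
  measurable_pi_lambda _ fun l => measurable_ccol l.1

variable {Ω : Type*} [MeasurableSpace Ω] {P : Measure Ω}
  {X : Ω → Fin n → Fin p → ℝ} {Sig : Matrix (Fin p) (Fin p) ℝ} {S : Finset (Fin p)}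

/-- The centred Gram matrix of the core features is bounded below. -/
lemma IsHubDesign.measure_gram_le (hX : IsHubDesign P X Sig S) {Cmin : ℝ} (hC : 0 < Cmin)
    (hSig : ∀ μ ∈ spectrum ℝ
      (Sig.submatrix (Subtype.val : S → Fin p) (Subtype.val : S → Fin p)), Cmin ≤ μ) :
    P {ω | ¬ ∀ u : EuclideanSpace ℝ S,
        n / 2 * Cmin * ‖u‖ ^ 2 ≤ ‖∑ l, u l • ccol (X ω) l‖ ^ 2} ≤
      ENNReal.ofReal (9 ^ S.card * (3 * Real.exp (-(n : ℝ) / 128))) := by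
  have hpsd := hX.posSemidef.submatrix (Subtype.val : S → Fin p)
  have hlow := le_quadForm_of_spectrum hpsd hSig
  obtain ⟨B, hB⟩ := exists_whitening hpsd hC hlow
  obtain ⟨N, hNcard, hN1, hNnet⟩ := exists_sphere_net (E := EuclideanSpace ℝ S)
  -- In whitened coordinates a unit vector `y` corresponds to a combination of core columns with
  -- independent standard normal entries, so one concentration bound serves the whole net.
  let T (ω : Ω) : EuclideanSpace ℝ S →ₗ[ℝ] EuclideanSpace ℝ (Fin n) :=
    (Fintype.linearCombination ℝ fun l : S => ccol (X ω) l) ∘ₗ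
      (WithLp.linearEquiv 2 ℝ (S → ℝ)).toLinearMap ∘ₗ B.symm.toLinearMap
  have hTapp (ω : Ω) (y : EuclideanSpace ℝ S) :
      T ω y = ∑ l, (B.symm y) l • ccol (X ω) l := by
    simp [T, Fintype.linearCombination_apply]
  have hsub : {ω | ¬ ∀ u : EuclideanSpace ℝ S,
      n / 2 * Cmin * ‖u‖ ^ 2 ≤ ‖∑ l, u l • ccol (X ω) l‖ ^ 2} ⊆
      ⋃ y ∈ N, {ω | ¬ |‖T ω y‖ ^ 2 - n| ≤ n / 4} := by
    intro ω hω
    simp only [Set.mem_iUnion, Set.mem_ofPred_eq, exists_prop]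
    by_contra! hc
    refine hω fun u => ?_
    have h1 := half_le_of_net (T ω) n N hN1 hNnet hc (B u)
    rw [hTapp, LinearEquiv.symm_apply_apply, hB] at h1
    refine le_trans ?_ h1
    rw [mul_assoc]
    gcongr
    exact hlow u
  have hpt (y : EuclideanSpace ℝ S) (hy : y ∈ N) :
      P {ω | ¬ |‖T ω y‖ ^ 2 - n| ≤ n / 4} ≤
        ENNReal.ofReal (3 * Real.exp (-(n : ℝ) / 128)) := by
    have hlaw := hX.hasLaw_linear (Subtype.val : S → Fin p) (B.symm y).ofLp
    rw [← hB, LinearEquiv.apply_symm_apply, hN1 y hy, one_pow, Real.toNNReal_one] at hlaw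
    have hT : ∀ ω, T ω y =
        (centeredSpace n).starProjection (∑ l, (B.symm y) l • col (X ω) l) := by
      intro ω
      rw [hTapp, map_sum]
      simp_rw [map_smul]
      rfl
    simp_rw [hT]
    have hms : MeasurableSet {x : EuclideanSpace ℝ (Fin n) |
        |‖(centeredSpace n).starProjection x‖ ^ 2 - n| ≤ n / 4} :=
      measurableSet_le (by fun_prop) (by fun_prop)
    exact measure_le_of_hasLaw hlaw (B := {x | ¬ |‖(centeredSpace n).starProjection x‖ ^ 2 - n| ≤
      n / 4}) hms.compl (gaussVec_centered_concentration n (ones n))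
  calc _ ≤ _ := measure_mono hsub
    _ ≤ ∑ y ∈ N, P {ω | ¬ |‖T ω y‖ ^ 2 - n| ≤ n / 4} := measure_biUnion_finset_le _ _
    _ ≤ ∑ _y ∈ N, ENNReal.ofReal (3 * Real.exp (-(n : ℝ) / 128)) := Finset.sum_le_sum hpt
    _ ≤ _ := by
      rw [Finset.sum_const, nsmul_eq_mul, ENNReal.ofReal_mul (p := 9 ^ S.card) (by positivity),
        ENNReal.ofReal_pow (by norm_num)]
      gcongr ?_ * _
      have : (N.card : ℝ≥0∞) ≤ ((9 ^ S.card : ℕ) : ℝ≥0∞) := by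
        exact_mod_cast (by simpa using hNcard)
      simpa using this

/-- The projections of the error variables onto the core features are small. -/
lemma IsHubDesign.measure_residual_le [IsProbabilityMeasure P] (hX : IsHubDesign P X Sig S)
    {Γ : S → {j // j ∉ S} → ℝ} (j : {j // j ∉ S}) {v : ℝ≥0} (hv0 : 0 < v)
    (hv : ∀ i, HasLaw (fun ω => residual S Γ (X ω i) j) (gaussianReal 0 v) P)
    (hi : ∀ i, IndepFun (fun ω (l : S) => X ω i l.1) (fun ω => residual S Γ (X ω i)) P) (T : ℝ) :
    P {ω | v * T ≤ ‖(coreSpan S (X ω)).starProjection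
        (WithLp.toLp 2 fun i => residual S Γ (X ω i) j)‖ ^ 2} ≤
      ENNReal.ofReal (Real.exp (-T / 4) * √2 ^ S.card) := by
  obtain ⟨μ, hμ, hlaw⟩ := hX.hasLaw_core_residual j hv hi
  let x (a : Fin n → S → ℝ) (l : S) : EuclideanSpace ℝ (Fin n) :=
    (centeredSpace n).starProjection (WithLp.toLp 2 fun i => a i l)
  have hx : Measurable x := measurable_pi_lambda _ fun l => by unfold x; fun_prop
  have hd (a : Fin n → S → ℝ) :
      Module.finrank ℝ (Submodule.span ℝ (Set.range (x a))) ≤ S.card := by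
    have h := finrank_range_le_card (R := ℝ) (x a)
    rw [Fintype.card_coe] at h
    exact h
  have hm : Measurable fun c : (Fin n → S → ℝ) × EuclideanSpace ℝ (Fin n) =>
      ‖(Submodule.span ℝ (Set.range (x c.1))).starProjection c.2‖ ^ 2 :=
    measurable_norm_sq_starProjection_span (hx.comp measurable_fst) measurable_snd
  have h1 (ω : Ω) : Submodule.span ℝ (Set.range (x fun i (l : S) => X ω i l.1)) =
      coreSpan S (X ω) := rfl
  simp_rw [← h1]
  -- Given the core features, the subspace is fixed and the error vector is still Gaussian, so the
  -- chi-square tail applies to each section.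
  exact measure_le_of_hasLaw_prod hlaw
    (fun a c => v * T ≤ ‖(Submodule.span ℝ (Set.range (x a))).starProjection c‖ ^ 2)
    (measurableSet_le measurable_const hm) (fun a => gaussVec_starProjection_ge hv0 _ T (hd a))

/-- Squared column norms are small. -/
lemma IsHubDesign.measure_col_le (hX : IsHubDesign P X Sig S) (j : Fin p) (T : ℝ) :
    P {ω | T ≤ ‖col (X ω) j‖ ^ 2} ≤ ENNReal.ofReal (Real.exp (-T / 4) * √2 ^ n) := by
  refine measure_le_of_hasLaw (hX.hasLaw_col j) (B := {x | T ≤ ‖x‖ ^ 2})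
    (measurableSet_le (by fun_prop) (by fun_prop)) ?_
  simpa [Submodule.starProjection_top] using
    gaussVec_starProjection_ge (n := n) one_pos ⊤ T (d := n) (by simp)

variable {σ : ℝ≥0} {ε : Ω → Fin n → ℝ}

lemma IsHubDesign.hasLaw_noise [IsProbabilityMeasure P] (hX : IsHubDesign P X Sig S)
    (hε_indep : iIndepFun (fun i ω => ε ω i) P)
    (hε_law : ∀ i, HasLaw (fun ω => ε ω i) (gaussianReal 0 (σ ^ 2)) P) (hXε : IndepFun X ε P) :
    HasLaw (fun ω => (X ω, (WithLp.toLp 2 (ε ω) : EuclideanSpace ℝ (Fin n))))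
      ((P.map X).prod (gaussVec n (σ ^ 2))) P :=
  IndepFun.hasLaw_prod ⟨hX.aemeasurable, rfl⟩ (hasLaw_gaussVec hε_indep hε_law)
    (hXε.comp measurable_id (by fun_prop))

/-- The projection of the noise onto the core features is small. -/
lemma IsHubDesign.measure_noise_proj_le [IsProbabilityMeasure P] (hX : IsHubDesign P X Sig S) (hσ : 0 < σ)
    (hε_indep : iIndepFun (fun i ω => ε ω i) P)
    (hε_law : ∀ i, HasLaw (fun ω => ε ω i) (gaussianReal 0 (σ ^ 2)) P) (hXε : IndepFun X ε P)
    (T : ℝ) :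
    P {ω | σ ^ 2 * T ≤ ‖(coreSpan S (X ω)).starProjection (WithLp.toLp 2 (ε ω))‖ ^ 2} ≤
      ENNReal.ofReal (Real.exp (-T / 4) * √2 ^ S.card) := by
  have := Measure.isProbabilityMeasure_map (μ := P) hX.aemeasurable
  exact measure_le_of_hasLaw_prod (hX.hasLaw_noise hε_indep hε_law hXε)
    (fun a c => σ ^ 2 * T ≤ ‖(coreSpan S a).starProjection c‖ ^ 2)
    (measurableSet_le measurable_const (measurable_norm_sq_starProjection_span
      ((measurable_ccol_core S).comp measurable_fst) measurable_snd))
    (fun a => by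
      simpa using gaussVec_starProjection_ge (pow_pos hσ 2) _ T (finrank_coreSpan_le S a))

/-- The correlation of the noise with the part of a feature orthogonal to the core features is
small. -/
lemma IsHubDesign.measure_noise_inner_le [IsProbabilityMeasure P] (hX : IsHubDesign P X Sig S) (hσ : 0 < σ)
    (hε_indep : iIndepFun (fun i ω => ε ω i) P)
    (hε_law : ∀ i, HasLaw (fun ω => ε ω i) (gaussianReal 0 (σ ^ 2)) P) (hXε : IndepFun X ε P)
    (j : Fin p) (T : ℝ) :
    P {ω | σ ^ 2 * T * ‖ccol (X ω) j - (coreSpan S (X ω)).starProjection (ccol (X ω) j)‖ ^ 2 <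
        inner ℝ (ccol (X ω) j - (coreSpan S (X ω)).starProjection (ccol (X ω) j))
          (WithLp.toLp 2 (ε ω)) ^ 2} ≤
      ENNReal.ofReal (Real.exp (-T / 4) * √2) := by
  have := Measure.isProbabilityMeasure_map (μ := P) hX.aemeasurable
  have hc : Measurable fun c : (Fin n → Fin p → ℝ) × EuclideanSpace ℝ (Fin n) => ccol c.1 j :=
    (measurable_ccol j).comp measurable_fst
  have hS : Measurable fun (c : (Fin n → Fin p → ℝ) × EuclideanSpace ℝ (Fin n)) (l : S) =>
      ccol c.1 l := (measurable_ccol_core S).comp measurable_fst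
  have hin : Measurable fun c : (Fin n → Fin p → ℝ) × EuclideanSpace ℝ (Fin n) =>
      inner ℝ (ccol c.1 j - (coreSpan S c.1).starProjection (ccol c.1 j)) c.2 := by
    simp_rw [inner_sub_left]
    exact (hc.inner measurable_snd).sub (measurable_inner_starProjection_span hS hc measurable_snd)
  have hno : Measurable fun c : (Fin n → Fin p → ℝ) × EuclideanSpace ℝ (Fin n) =>
      ‖ccol c.1 j - (coreSpan S c.1).starProjection (ccol c.1 j)‖ ^ 2 := by
    -- Pythagoras reduces measurability of the orthogonal part to that of projection norms.
    have h1 (c : (Fin n → Fin p → ℝ) × EuclideanSpace ℝ (Fin n)) :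
        ‖ccol c.1 j - (coreSpan S c.1).starProjection (ccol c.1 j)‖ ^ 2 =
        ‖ccol c.1 j‖ ^ 2 - ‖(coreSpan S c.1).starProjection (ccol c.1 j)‖ ^ 2 := by
      have := (coreSpan S c.1).norm_sq_eq_add_norm_sq_starProjection (ccol c.1 j)
      rw [this, Submodule.starProjection_orthogonal_val]
      ring
    simp_rw [h1]
    exact (hc.norm.pow_const 2).sub (measurable_norm_sq_starProjection_span hS hc)
  exact measure_le_of_hasLaw_prod (hX.hasLaw_noise hε_indep hε_law hXε)
    (fun a c => σ ^ 2 * T * ‖ccol a j - (coreSpan S a).starProjection (ccol a j)‖ ^ 2 <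
        inner ℝ (ccol a j - (coreSpan S a).starProjection (ccol a j)) c ^ 2)
    (measurableSet_lt (hno.const_mul _) (hin.pow_const 2))
    (fun a => by simpa using gaussVec_inner_sq_gt (pow_pos hσ 2) _ T)

end Events

/-! ### Good samples -/

variable {n p : ℕ}

/-- The deterministic properties of a sample on which support recovery is based. -/
structure GoodSample (S : Finset (Fin p)) (Cmin σ : ℝ) (X : Fin n → Fin p → ℝ)
    (e : Fin n → ℝ) : Prop where
  gram : ∀ u : EuclideanSpace ℝ S, n / 2 * Cmin * ‖u‖ ^ 2 ≤ ‖∑ l, u l • ccol X l‖ ^ 2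
  residual : ∀ j ∉ S, ∃ (Γ : EuclideanSpace ℝ S) (ε : EuclideanSpace ℝ (Fin n)),
    ccol X j = ∑ l, Γ l • ccol X l + ε ∧ Cmin * ‖Γ‖ ^ 2 ≤ 1 ∧
      ‖(coreSpan S X).starProjection ε‖ ^ 2 ≤ 2 * S.card + 6 * Real.log p
  noise_inner : ∀ j, |inner ℝ (ccol X j - (coreSpan S X).starProjection (ccol X j))
    ((centeredSpace n).starProjection (WithLp.toLp 2 e))| ≤ 8 * (n * noiseLevel σ n p)
  noise_proj : ‖(coreSpan S X).starProjection ((centeredSpace n).starProjection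
    (WithLp.toLp 2 e))‖ ^ 2 ≤ σ ^ 2 * (2 * S.card + 6 * Real.log p)

lemma ccol_eq_add_residual (S : Finset (Fin p)) (Γ : S → {j // j ∉ S} → ℝ)
    (X : Fin n → Fin p → ℝ) (j : {j // j ∉ S}) :
    ccol X j = ∑ l : S, Γ l j • ccol X l + (centeredSpace n).starProjection
      (WithLp.toLp 2 fun i => residual S Γ (X i) j) := by
  have h : col X j = ∑ l : S, Γ l j • col X l +
      WithLp.toLp 2 fun i => residual S Γ (X i) j := by
    ext i
    simp [col, residual, mul_comm]
  rw [ccol, h, map_add, map_sum]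
  simp_rw [map_smul]
  rfl

/-- The scaled noise level is `σ √L √(n + L)`: a Gaussian maximum over `p` features times a uniform
bound on column norms. The summand `L` keeps that bound valid when `log p` exceeds `n`. -/
lemma sq_mul_noiseLevel (hn : 0 < n) (σ : ℝ) :
    (n * noiseLevel σ n p) ^ 2 = σ ^ 2 * (Real.log p * (n + Real.log p)) := by
  have hL : 0 ≤ Real.log p := Real.log_natCast_nonneg p
  have hn' : (0 : ℝ) < n := by exact_mod_cast hn
  rw [noiseLevel, mul_pow, mul_pow, Real.sq_sqrt (by positivity)]
  field_simp

variable {Ω : Type*} [MeasurableSpace Ω] {P : Measure Ω}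
  {X : Ω → Fin n → Fin p → ℝ} {Sig : Matrix (Fin p) (Fin p) ℝ} {S : Finset (Fin p)}
  {σ : ℝ≥0} {ε : Ω → Fin n → ℝ}

lemma sqrt_two_pow_le (d : ℕ) : √2 ^ d ≤ Real.exp (d / 2) := by
  have h : √2 ≤ Real.exp (1 / 2) := by
    rw [Real.sqrt_le_left (Real.exp_pos _).le, ← Real.exp_nat_mul]
    refine le_trans ?_ (Real.add_one_le_exp _)
    norm_num
  calc √2 ^ d ≤ Real.exp (1 / 2) ^ d := by gcongr
    _ = Real.exp (d / 2) := by rw [← Real.exp_nat_mul]; congr 1; ring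

lemma measure_exists_le {ι : Type*} [Fintype ι] (q : ι → Ω → Prop) {δ : ℝ}
    (h : ∀ j, P {ω | q j ω} ≤ ENNReal.ofReal δ) :
    P {ω | ∃ j, q j ω} ≤ ENNReal.ofReal (Fintype.card ι * δ) := by
  have h1 : {ω | ∃ j, q j ω} = ⋃ j, {ω | q j ω} := by ext; simp
  rw [h1]
  calc _ ≤ ∑ j, P {ω | q j ω} := measure_iUnion_fintype_le _ _
    _ ≤ ∑ _j : ι, ENNReal.ofReal δ := Finset.sum_le_sum fun j _ => h j
    _ = _ := by
      rw [Finset.sum_const, nsmul_eq_mul, ENNReal.ofReal_mul (by positivity), Finset.card_univ,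
        ENNReal.ofReal_natCast]

/-- A sample is good up to an explicit small probability. -/
lemma IsHubDesign.measure_not_goodSample_le [IsProbabilityMeasure P] (hX : IsHubDesign P X Sig S) (hn : 0 < n) (hp : 0 < p)
    {Cmin : ℝ} (hC : 0 < Cmin)
    (hSig : ∀ μ ∈ spectrum ℝ
      (Sig.submatrix (Subtype.val : S → Fin p) (Subtype.val : S → Fin p)), Cmin ≤ μ)
    (hσ : 0 < σ) (hε_indep : iIndepFun (fun i ω => ε ω i) P)
    (hε_law : ∀ i, HasLaw (fun ω => ε ω i) (gaussianReal 0 (σ ^ 2)) P) (hXε : IndepFun X ε P) :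
    P {ω | ¬ GoodSample S Cmin σ (X ω) (ε ω)} ≤
      ENNReal.ofReal (9 ^ S.card * (3 * Real.exp (-(n : ℝ) / 128)) +
        5 * Real.exp (-Real.log p / 2)) := by
  obtain ⟨Γ, v, hv0, hcore⟩ := hX.core_model
  set L := Real.log p with hLdef
  have hL : 0 ≤ L := Real.log_natCast_nonneg p
  have hpL : (p : ℝ) = Real.exp L := (Real.exp_log (by exact_mod_cast hp)).symm
  have hdec (j : {j // j ∉ S}) : Cmin * ‖(WithLp.toLp 2 fun l => Γ l j : EuclideanSpace ℝ S)‖ ^ 2 ≤ 1 ∧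
      v j ≤ (1 : ℝ) := by
    have h1 := hX.variance_decomposition j ⟨0, hn⟩ ((hcore ⟨0, hn⟩).1 j) (hcore ⟨0, hn⟩).2.2
    have h2 := le_quadForm_of_spectrum (hX.posSemidef.submatrix (Subtype.val : S → Fin p)) hSig
      (WithLp.toLp 2 fun l => Γ l j)
    have h3 : (0 : ℝ) ≤ v j := (v j).2
    have h4 : 0 ≤ Cmin * ‖(WithLp.toLp 2 fun l => Γ l j : EuclideanSpace ℝ S)‖ ^ 2 := by positivity
    simp only at h2
    constructor <;> linarith
  -- Chosen so that `exp (-Tr/4) √2 ^ s ≤ exp (-3L/2)`, that is `p^(-3/2)`: the term `2s` absorbs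
  -- the dimension and `6L` leaves `p^(-1/2)` after a union over features.
  let Tr : ℝ := 2 * S.card + 6 * L
  have hTr : 0 ≤ Tr := by
    have : (0 : ℝ) ≤ S.card := Nat.cast_nonneg _
    simp only [Tr]
    linarith
  let Bg : Set Ω := {ω | ¬ ∀ u : EuclideanSpace ℝ S,
        n / 2 * Cmin * ‖u‖ ^ 2 ≤ ‖∑ l, u l • ccol (X ω) l‖ ^ 2}
  let Br : Set Ω := {ω | ∃ j, v j * Tr ≤ ‖(coreSpan S (X ω)).starProjection
        (WithLp.toLp 2 fun i => HubNet.residual S Γ (X ω i) j)‖ ^ 2}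
  -- The two factors `8`, here and in `Bi`, multiply to `8²`, giving the constant `8` in
  -- `noise_inner`; each tail exponent contains `-2L`, enough for a union over `p` columns.
  let Bc : Set Ω := {ω | ∃ j, 8 * (n + L) ≤ ‖col (X ω) j‖ ^ 2}
  let Bi : Set Ω := {ω | ∃ j, σ ^ 2 * (8 * L) *
        ‖ccol (X ω) j - (coreSpan S (X ω)).starProjection (ccol (X ω) j)‖ ^ 2 <
        inner ℝ (ccol (X ω) j - (coreSpan S (X ω)).starProjection (ccol (X ω) j))
          (WithLp.toLp 2 (ε ω)) ^ 2}
  let Bp : Set Ω :=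
    {ω | σ ^ 2 * Tr ≤ ‖(coreSpan S (X ω)).starProjection (WithLp.toLp 2 (ε ω))‖ ^ 2}
  have hsub : {ω | ¬ GoodSample S Cmin σ (X ω) (ε ω)} ⊆ Bg ∪ (Br ∪ (Bc ∪ (Bi ∪ Bp))) := by
    intro ω hω
    by_contra hc
    simp only [Set.mem_union, not_or, Bg, Br, Bc, Bi, Bp, Set.mem_ofPred_eq, not_not, not_exists,
      not_le, not_lt] at hc
    obtain ⟨hg, hr, hcl, hin, hpr⟩ := hc
    refine hω ⟨hg, fun j hj => ?_, fun j => ?_, ?_⟩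
    · refine ⟨WithLp.toLp 2 fun l => Γ l ⟨j, hj⟩, _, ccol_eq_add_residual S Γ (X ω) ⟨j, hj⟩,
        (hdec ⟨j, hj⟩).1, ?_⟩
      rw [starProjection_coreSpan_centered]
      refine (hr ⟨j, hj⟩).le.trans ?_
      exact mul_le_of_le_one_left hTr (hdec ⟨j, hj⟩).2
    · set h := ccol (X ω) j - (coreSpan S (X ω)).starProjection (ccol (X ω) j)
      have hmem : h ∈ centeredSpace n :=
        Submodule.sub_mem _ (Submodule.starProjection_apply_mem _ _)
          (coreSpan_le S (X ω) (Submodule.starProjection_apply_mem _ _))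
      rw [← Submodule.inner_starProjection_left_eq_right,
        Submodule.starProjection_eq_self_iff.2 hmem]
      have hh : ‖h‖ ^ 2 ≤ 8 * (n + L) := by
        refine le_trans ?_ (hcl j).le
        gcongr
        have h1 := (coreSpan S (X ω)).norm_sq_eq_add_norm_sq_starProjection (ccol (X ω) j)
        rw [Submodule.starProjection_orthogonal_val] at h1
        have h2 : ‖h‖ ≤ ‖ccol (X ω) j‖ := by
          refine abs_le_of_sq_le_sq' ?_ (norm_nonneg _) |>.2
          rw [h1]
          exact le_add_of_nonneg_left (sq_nonneg _)
        exact h2.trans (Submodule.norm_starProjection_apply_le _ _)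
      have hnl : 0 ≤ n * noiseLevel σ n p :=
        mul_nonneg (Nat.cast_nonneg _) (mul_nonneg σ.2 (Real.sqrt_nonneg _))
      refine abs_le_of_sq_le_sq ?_ (by positivity)
      rw [mul_pow, sq_mul_noiseLevel hn]
      refine (hin j).trans ?_
      calc σ ^ 2 * (8 * L) * ‖h‖ ^ 2 ≤ σ ^ 2 * (8 * L) * (8 * (n + L)) := by gcongr
        _ = _ := by rw [← hLdef]; ring
    · rw [starProjection_coreSpan_centered]
      exact hpr.le
  have hE : Real.exp (-Tr / 4) * √2 ^ S.card ≤ Real.exp (-(3 / 2) * L) := by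
    calc _ ≤ Real.exp (-Tr / 4) * Real.exp (S.card / 2) := by gcongr; exact sqrt_two_pow_le _
      _ = _ := by rw [← Real.exp_add]; congr 1; simp only [Tr]; ring
  have hq : Real.exp (-(3 / 2) * L) ≤ Real.exp (-L / 2) := Real.exp_le_exp.2 (by linarith)
  have hpm (a : ℝ) : p * Real.exp a = Real.exp (L + a) := by rw [hpL, Real.exp_add]
  have bg := hX.measure_gram_le hC hSig
  have br : P Br ≤ ENNReal.ofReal (Real.exp (-L / 2)) := by
    refine (measure_exists_le _ fun j => hX.measure_residual_le j (hv0 j)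
      (fun i => (hcore i).1 j) (fun i => (hcore i).2.2) Tr).trans (ENNReal.ofReal_le_ofReal ?_)
    calc _ ≤ (p : ℝ) * Real.exp (-(3 / 2) * L) := by
          gcongr
          exact (Fintype.card_subtype_le _).trans_eq (Fintype.card_fin p)
      _ = _ := by rw [hpm]; congr 1; ring
  have bc : P Bc ≤ ENNReal.ofReal (Real.exp (-L / 2)) := by
    refine (measure_exists_le _ fun j => hX.measure_col_le j (8 * (n + L))).trans
      (ENNReal.ofReal_le_ofReal ?_)
    rw [Fintype.card_fin]
    calc _ ≤ (p : ℝ) * (Real.exp (-(8 * (n + L)) / 4) * Real.exp (n / 2)) := by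
          gcongr; exact sqrt_two_pow_le _
      _ ≤ _ := by
          rw [← Real.exp_add, hpm]
          apply Real.exp_le_exp.2
          linarith [(Nat.cast_nonneg n : (0 : ℝ) ≤ n)]
  have bi : P Bi ≤ ENNReal.ofReal (2 * Real.exp (-L / 2)) := by
    refine (measure_exists_le _ fun j => hX.measure_noise_inner_le hσ hε_indep hε_law hXε j
      (8 * L)).trans (ENNReal.ofReal_le_ofReal ?_)
    rw [Fintype.card_fin, ← mul_assoc, hpm, mul_comm]
    gcongr
    · exact (Real.sqrt_le_left (by norm_num)).2 (by norm_num)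
    · linarith
  have bp : P Bp ≤ ENNReal.ofReal (Real.exp (-L / 2)) :=
    (hX.measure_noise_proj_le hσ hε_indep hε_law hXε Tr).trans
      (ENNReal.ofReal_le_ofReal (hE.trans hq))
  calc _ ≤ _ := measure_mono hsub
    _ ≤ P Bg + (P Br + (P Bc + (P Bi + P Bp))) := by
      refine (measure_union_le _ _).trans ?_
      gcongr
      refine (measure_union_le _ _).trans ?_
      gcongr
      refine (measure_union_le _ _).trans ?_
      gcongr
      exact measure_union_le _ _
    _ ≤ _ := by
      refine (add_le_add bg (add_le_add br (add_le_add bc (add_le_add bi bp)))).trans ?_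
      rw [← ENNReal.ofReal_add (by positivity) (by positivity),
        ← ENNReal.ofReal_add (by positivity) (by positivity),
        ← ENNReal.ofReal_add (by positivity) (by positivity),
        ← ENNReal.ofReal_add (by positivity) (by positivity)]
      apply ENNReal.ofReal_le_ofReal
      linarith

/-! ### Support recovery on good samples -/

section Recovery

variable {n p : ℕ} {S : Finset (Fin p)} {w : Fin p → ℝ≥0∞}

lemma le_wMax {j : Fin p} (hj : j ∈ S) : w j ≤ wMax S w := le_iSup₂_of_le j hj le_rfl

lemma wMin_le {j : Fin p} (hj : j ∉ S) : wMin S w ≤ w j := iInf₂_le_of_le j hj le_rfl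

/-- The convention `∞ / ∞ = ∞` enters here: an infinite core weight makes `rho` infinite and
violates the gap, so no core feature is excluded a priori. -/
lemma wMax_ne_top_of_rho {K c : ℝ} (hK : 0 < K)
    (h : rho S w * ENNReal.ofReal K ≤ ENNReal.ofReal c) : wMax S w ≠ ∞ := by
  intro htop
  rw [rho, if_pos htop, ENNReal.top_mul (by simpa using hK), top_le_iff] at h
  exact ENNReal.ofReal_ne_top h

lemma wMax_mul_le_of_rho {K c : ℝ} (hK : 0 < K) (hc : 0 ≤ c)
    (h : rho S w * ENNReal.ofReal K ≤ ENNReal.ofReal c) (hmin : wMin S w ≠ ∞) :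
    (wMax S w).toReal * K ≤ c * (wMin S w).toReal := by
  have htop := wMax_ne_top_of_rho hK h
  rw [rho, if_neg htop, ENNReal.mul_comm_div, ← mul_div_assoc,
    ENNReal.div_le_iff_le_mul (.inr ENNReal.ofReal_ne_top) (.inl hmin)] at h
  have h1 := ENNReal.toReal_mono (ENNReal.mul_ne_top ENNReal.ofReal_ne_top hmin) h
  rwa [ENNReal.toReal_mul, ENNReal.toReal_mul, ENNReal.toReal_ofReal hK.le,
    ENNReal.toReal_ofReal hc] at h1

lemma mul_noise_le_of_wMin {M : ℝ≥0} {a l : ℝ} (ha : 0 ≤ a) (hl : 0 ≤ l)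
    (h : M * ((wMin S w)⁻¹ * ENNReal.ofReal a) ≤ ENNReal.ofReal l) (hmin : wMin S w ≠ ∞) :
    M * a ≤ l * (wMin S w).toReal := by
  have e : M * ((wMin S w)⁻¹ * ENNReal.ofReal a) = M * ENNReal.ofReal a / wMin S w := by
    rw [ENNReal.div_eq_inv_mul]; ring
  rw [e, ENNReal.div_le_iff_le_mul (.inr ENNReal.ofReal_ne_top) (.inl hmin)] at h
  have h1 := ENNReal.toReal_mono (ENNReal.mul_ne_top ENNReal.ofReal_ne_top hmin) h
  rwa [ENNReal.toReal_mul, ENNReal.toReal_mul, ENNReal.toReal_ofReal ha, ENNReal.coe_toReal,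
    ENNReal.toReal_ofReal hl] at h1

lemma mul_le_of_le_div_wMax {M : ℝ≥0} {a l t : ℝ} (ha : 0 ≤ a) (hl : 0 ≤ l) (ht : 0 ≤ t)
    (h : M * ENNReal.ofReal l ≤ ENNReal.ofReal a / (wMax S w * ENNReal.ofReal t)) :
    M * l * ((wMax S w).toReal * t) ≤ a := by
  have h1 := ENNReal.toReal_mono ENNReal.ofReal_ne_top (ENNReal.mul_le_of_le_div h)
  rwa [ENNReal.toReal_mul, ENNReal.toReal_mul, ENNReal.toReal_mul, ENNReal.toReal_ofReal ha,
    ENNReal.toReal_ofReal hl, ENNReal.toReal_ofReal ht, ENNReal.coe_toReal] at h1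

lemma noiseLevel_nonneg {σ : ℝ} (hσ : 0 ≤ σ) : 0 ≤ noiseLevel σ n p :=
  mul_nonneg hσ (Real.sqrt_nonneg _)

variable {X : Fin n → Fin p → ℝ} {e : Fin n → ℝ} {Cmin σ lam β0 b0 : ℝ} {β b : Fin p → ℝ}

lemma sqrt_half_mul_sq (hn : 0 < n) (hC : 0 < Cmin) :
    0 < √(n / 2 * Cmin) ∧ √(n / 2 * Cmin) ^ 2 = n / 2 * Cmin := by
  have hn' : (0 : ℝ) < n := by exact_mod_cast hn
  exact ⟨by positivity, Real.sq_sqrt (by positivity)⟩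

lemma sqrt_add_le {a c : ℝ} (ha : 0 ≤ a) (hc : 0 ≤ c) : √(a + c) ≤ √a + √c := by
  refine Real.sqrt_le_iff.2 ⟨by positivity, ?_⟩
  rw [add_sq, Real.sq_sqrt ha, Real.sq_sqrt hc]
  have : 0 ≤ 2 * √a * √c := by positivity
  linarith

/-- On a good sample, no inactive feature is selected. -/
lemma GoodSample.eq_zero_of_notMem (hg : GoodSample S Cmin σ X e) (hn : 0 < n) (hS : S.Nonempty)
    (hC : 0 < Cmin) (hσ : 0 ≤ σ) (hw : ∀ j, 0 < w j) (hlam : 0 < lam)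
    (h : IsAdaptiveLasso X (response S β0 β X e) lam w b0 b)
    {η : ℝ} (hη0 : 0 < η) (hη1 : η ≤ 1)
    (hgap : rho S w * ENNReal.ofReal (√(S.card / Cmin) * (1 + √(12 * Real.log p / n))) ≤
      ENNReal.ofReal (1 - η))
    (hlow : (Real.toNNReal (16 / η) : ℝ≥0∞) * ((wMin S w)⁻¹ *
      ENNReal.ofReal (noiseLevel σ n p)) ≤ ENNReal.ofReal (lam / n))
    (hsn : 2 * √(S.card / n) ≤ η / 4) :
    ∀ j ∉ S, b j = 0 := by
  have hn' : (0 : ℝ) < n := by exact_mod_cast hn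
  have hs : (0 : ℝ) < S.card := by exact_mod_cast hS.card_pos
  have hL : 0 ≤ Real.log p := Real.log_natCast_nonneg p
  set L := Real.log p with hLdef
  set K := √(S.card / Cmin) * (1 + √(12 * L / n)) with hKdef
  have hK : 0 < K := by positivity
  have hmax := wMax_ne_top_of_rho hK hgap
  set W := (wMax S w).toReal
  have hW : 0 ≤ W := ENNReal.toReal_nonneg
  obtain ⟨r, hr, hkkt⟩ := h.kkt hlam
  obtain ⟨hk, hk2⟩ := sqrt_half_mul_sq hn hC
  set k := √(n / 2 * Cmin)
  have hA (l : S) : |inner ℝ (ccol X l) r| ≤ lam * W := by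
    have hl : w l ≠ ∞ := ne_top_of_le_ne_top hmax (le_wMax l.2)
    refine (hkkt l hl).1.trans ?_
    gcongr
    exact ENNReal.toReal_mono hmax (le_wMax l.2)
  have hgram : ∀ u : EuclideanSpace ℝ S, k ^ 2 * ‖u‖ ^ 2 ≤ ‖∑ l, u l • ccol X l‖ ^ 2 := by
    rw [hk2]; exact hg.gram
  have hfin (j : Fin p) (hb : b j ≠ 0) : w j ≠ ∞ := fun htop =>
    hb (h.eq_zero_of_weight_top hlam j htop)
  refine eq_zero_of_dual_feasible S (ccol X) (coreSpan S X) (fun j => ccol_mem_coreSpan X) _ r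
    (fun j => β j - b j) b (fun j => lam * (w j).toReal) hr
    (fun j hj hb => (hkkt j (hfin j hb)).2) (fun j hj hb => ?_)
  have hwj := hfin j hb
  -- A selected feature has finite weight, so the extended conditions become real inequalities; an
  -- infinite minimum leaves nothing to prove.
  have hmin : wMin S w ≠ ∞ := ne_top_of_le_ne_top hwj (wMin_le hj)
  set m := (wMin S w).toReal
  have hmj : m ≤ (w j).toReal := ENNReal.toReal_mono hwj (wMin_le hj)
  have hwj0 : 0 < (w j).toReal := ENNReal.toReal_pos (hw j).ne' hwj
  have hm0 : 0 ≤ m := ENNReal.toReal_nonneg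
  have g1 : W * K ≤ (1 - η) * m := wMax_mul_le_of_rho hK (by linarith) hgap hmin
  have g2 : 16 / η * noiseLevel σ n p ≤ lam / n * m := by
    have := mul_noise_le_of_wMin (noiseLevel_nonneg hσ) (by positivity) hlow hmin
    rwa [Real.coe_toNNReal _ (by positivity)] at this
  have g3 : 8 * (n * noiseLevel σ n p) ≤ η / 2 * (lam * m) := by
    rw [div_mul_eq_mul_div, div_mul_eq_mul_div, div_le_div_iff₀ hη0 hn'] at g2
    linarith
  obtain ⟨Γ, ε, hj1, hΓ, hε⟩ := hg.residual j hj
  have hΓ' : ‖Γ‖ ≤ √(1 / Cmin) := by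
    apply Real.le_sqrt_of_sq_le
    rwa [le_div_iff₀ hC, mul_comm]
  have hε' : ‖(coreSpan S X).starProjection ε‖ ≤ √(2 * S.card + 6 * L) := Real.le_sqrt_of_sq_le hε
  have d1 := abs_inner_starProjection_le hk hgram (by positivity) hA Γ ε hΓ' hε'
  rw [← hj1, Fintype.card_coe] at d1
  have d2 : √S.card * (lam * W) * (√(1 / Cmin) + √(2 * S.card + 6 * L) / k) ≤
      lam * (W * K) * (1 + η / 4) := by
    -- Dividing `6L` by `k² = n Cmin/2` produces the `12 L / n` of the weight gap; the remaining
    -- `4s/n` is absorbed in `η/4` because `s ≪ n`.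
    have e1 : √(2 * S.card + 6 * L) / k = √(1 / Cmin) * √(4 * (S.card / n) + 12 * L / n) := by
      rw [← Real.sqrt_div (by positivity), ← Real.sqrt_mul (by positivity)]
      congr 1
      field_simp
      ring
    have e2 : √(4 * (S.card / n) + 12 * L / n) ≤ η / 4 + √(12 * L / n) := by
      refine (sqrt_add_le (by positivity) (by positivity)).trans ?_
      rw [Real.sqrt_mul (by norm_num), show √(4 : ℝ) = 2 by
        rw [show (4 : ℝ) = 2 ^ 2 by norm_num, Real.sqrt_sq (by norm_num)]]
      linarith
    have e3 : √(S.card / Cmin) = √S.card * √(1 / Cmin) := by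
      rw [← Real.sqrt_mul (by positivity), mul_one_div]
    rw [e1, hKdef, e3]
    have h0 : 0 ≤ √S.card * √(1 / Cmin) * (lam * W) := by positivity
    have e4 : 1 + √(4 * (S.card / n) + 12 * L / n) ≤ (1 + √(12 * L / n)) * (1 + η / 4) := by
      nlinarith [Real.sqrt_nonneg (12 * L / n)]
    calc _ = √S.card * √(1 / Cmin) * (lam * W) * (1 + √(4 * (S.card / n) + 12 * L / n)) := by ring
      _ ≤ √S.card * √(1 / Cmin) * (lam * W) * ((1 + √(12 * L / n)) * (1 + η / 4)) := by gcongr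
      _ = _ := by ring
  -- Budget: `(1 - η)(1 + η/4) ≤ 1 - 3η/4`, and the noise adds `η/2`, leaving a strict margin `η/4`.
  have d3 : lam * (W * K) * (1 + η / 4) ≤ lam * m * (1 - 3 / 4 * η) := by
    calc _ ≤ lam * ((1 - η) * m) * (1 + η / 4) := by gcongr
      _ = lam * m * (1 - 3 / 4 * η) - lam * m * (η ^ 2 / 4) := by ring
      _ ≤ _ := by
        have : 0 ≤ lam * m * (η ^ 2 / 4) := by positivity
        linarith
  have d4 := hg.noise_inner j
  have d5 : lam * m * (1 - η / 4) ≤ lam * (w j).toReal * (1 - η / 4) := by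
    gcongr
    linarith
  have d6 : 0 < lam * (w j).toReal * (η / 4) := by positivity
  change |inner ℝ (ccol X j) ((coreSpan S X).starProjection r)| ≤ _ at d1
  calc _ ≤ lam * m * (1 - 3 / 4 * η) + η / 2 * (lam * m) :=
        add_le_add (d1.trans (d2.trans d3)) (d4.trans g3)
    _ = lam * m * (1 - η / 4) := by ring
    _ < lam * (w j).toReal := by linarith

/-- On a good sample, every active feature with a strong signal is selected. -/
lemma GoodSample.ne_zero_of_mem (hg : GoodSample S Cmin σ X e) (hn : 0 < n) (hS : S.Nonempty)
    (hL : 1 ≤ Real.log p)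
    (hC : 0 < Cmin) (hσ : 0 ≤ σ) (hlam : 0 < lam)
    (h : IsAdaptiveLasso X (response S β0 β X e) lam w b0 b) (hmax : wMax S w ≠ ∞)
    (hb : ∀ j ∉ S, b j = 0) {βmin : ℝ} (hβ0 : 0 < βmin) (hβ : ∀ j ∈ S, βmin ≤ |β j|)
    (hsig : σ * √((S.card * Real.log p / n) * (1 + Real.log p / n)) ≤ √Cmin / 16 * βmin)
    (hup : (Real.toNNReal (8 / Cmin) : ℝ≥0∞) * ENNReal.ofReal (lam / n) ≤
      ENNReal.ofReal βmin / (wMax S w * ENNReal.ofReal √(S.card : ℝ))) :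
    ∀ j ∈ S, b j ≠ 0 := by
  have hn' : (0 : ℝ) < n := by exact_mod_cast hn
  have hs : (1 : ℝ) ≤ S.card := by exact_mod_cast hS.card_pos
  set L := Real.log p
  obtain ⟨r, hr, hkkt⟩ := h.kkt hlam
  obtain ⟨hk, hk2⟩ := sqrt_half_mul_sq hn hC
  have hgram := hg.gram
  rw [← hk2] at hgram
  set W := (wMax S w).toReal
  have hA (l : S) : |inner ℝ (ccol X l) r| ≤ lam * W := by
    have hl : w l ≠ ∞ := ne_top_of_le_ne_top hmax (le_wMax l.2)
    refine (hkkt l hl).1.trans ?_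
    gcongr
    exact ENNReal.toReal_mono hmax (le_wMax l.2)
  have hr' : r = (centeredSpace n).starProjection (WithLp.toLp 2 e) +
      ∑ l : S, (WithLp.toLp 2 fun l : S => β l - b l : EuclideanSpace ℝ S) l • ccol X l := by
    rw [hr, Finset.sum_eq_zero (s := Sᶜ)
      (fun j hj => by rw [hb j (Finset.mem_compl.1 hj), zero_smul]), sub_zero]
    congr 1
    exact (Finset.sum_coe_sort S fun j => (β j - b j) • ccol X j).symm
  have d1 := norm_error_le hk hgram hA _ _ hr'
  rw [Fintype.card_coe, hk2] at d1
  set k := √(n / 2 * Cmin)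
  have d2 : ‖(coreSpan S X).starProjection ((centeredSpace n).starProjection
      (WithLp.toLp 2 e))‖ / k ≤ βmin / 4 := by
    have hZ := Real.le_sqrt_of_sq_le hg.noise_proj
    have e1 : √(σ ^ 2 * (2 * S.card + 6 * L)) / k ≤
        4 / √Cmin * (σ * √((S.card * L / n) * (1 + L / n))) := by
      rw [← Real.sqrt_div (by positivity)]
      refine Real.sqrt_le_iff.2 ⟨by positivity, ?_⟩
      rw [mul_pow, div_pow, Real.sq_sqrt hC.le, mul_pow, Real.sq_sqrt (by positivity)]
      -- Uses `s ≥ 1` and `L ≥ 1`; dividing by `k²` then gives the constant `16 = 4²`.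
      have e2 : 2 * S.card + 6 * L ≤ 8 * (S.card * L) := by nlinarith
      have e3 : S.card * L / n ≤ S.card * L / n * (1 + L / n) :=
        le_mul_of_one_le_right (by positivity) (by linarith [(by positivity : 0 ≤ L / n)])
      calc σ ^ 2 * (2 * S.card + 6 * L) / (n / 2 * Cmin)
          ≤ σ ^ 2 * (8 * (S.card * L)) / (n / 2 * Cmin) := by gcongr
        _ = 4 ^ 2 / Cmin * (σ ^ 2 * (S.card * L / n)) := by field_simp; ring
        _ ≤ _ := by gcongr
    calc _ ≤ √(σ ^ 2 * (2 * S.card + 6 * L)) / k := by gcongr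
      _ ≤ 4 / √Cmin * (σ * √((S.card * L / n) * (1 + L / n))) := e1
      _ ≤ 4 / √Cmin * (√Cmin / 16 * βmin) := by gcongr
      _ = βmin / 4 := by
        have : 0 < √Cmin := by positivity
        field_simp; ring
  have d3 : √S.card * (lam * W) / (n / 2 * Cmin) ≤ βmin / 4 := by
    have := mul_le_of_le_div_wMax hβ0.le (by positivity) (Real.sqrt_nonneg _) hup
    rw [Real.coe_toNNReal _ (by positivity)] at this
    have e1 : √S.card * (lam * W) / (n / 2 * Cmin) =
        8 / Cmin * (lam / n) * (W * √S.card) / 4 := by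
      field_simp; ring
    rw [e1]
    linarith
  -- A missed core feature would contribute its full `|β j| ≥ βmin` to the error, which is at most
  -- `βmin / 2`.
  intro j hj hbj
  have d4 : |β j| ≤ ‖(WithLp.toLp 2 fun l : S => β l - b l : EuclideanSpace ℝ S)‖ := by
    have := PiLp.norm_apply_le (WithLp.toLp 2 fun l : S => β l - b l : EuclideanSpace ℝ S) ⟨j, hj⟩
    simpa [hbj] using this
  change _ ≤ ‖(coreSpan S X).starProjection _‖ / k + _ at d1
  linarith [hβ j hj]

end Recovery

/-! ### Asymptotics -/

section Asymptotic

variable {Ω : ℕ → Type*} [∀ k, MeasurableSpace (Ω k)] {P : ∀ k, Measure (Ω k)}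
  [∀ k, IsProbabilityMeasure (P k)]

/-- Null measurability is essential: the outer measures of a set and its complement may both be `1`.
-/
lemma WHP.tendsto_compl {E : ∀ k, Set (Ω k)} (h : WHP P E)
    (hE : ∀ k, NullMeasurableSet (E k) (P k)) :
    Tendsto (fun k => P k (E k)ᶜ) atTop (𝓝 0) := by
  have h1 : ∀ k, P k (E k)ᶜ = 1 - P k (E k) := fun k => prob_compl_eq_one_sub₀ (hE k)
  simp_rw [h1]
  simpa using ENNReal.Tendsto.sub tendsto_const_nhds h (.inl ENNReal.one_ne_top)

/-- Subadditivity alone suffices, so `F` need not be measurable; this allows an arbitrary, possibly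
non-measurable choice of minimizer. -/
lemma tendsto_one_of_compl_le {F : ∀ k, Set (Ω k)} {g : ℕ → ℝ≥0∞} (hg : Tendsto g atTop (𝓝 0))
    (h : ∀ᶠ k in atTop, P k (F k)ᶜ ≤ g k) : Tendsto (fun k => P k (F k)) atTop (𝓝 1) := by
  have h1 : Tendsto (fun k => 1 - g k) atTop (𝓝 1) := by
    simpa using ENNReal.Tendsto.sub (tendsto_const_nhds (x := (1 : ℝ≥0∞))) hg
      (.inl ENNReal.one_ne_top)
  refine tendsto_of_tendsto_of_tendsto_of_le_of_le' h1 tendsto_const_nhds ?_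
    (Eventually.of_forall fun k => prob_le_one)
  filter_upwards [h] with k hk
  rw [tsub_le_iff_right]
  calc 1 = P k (F k ∪ (F k)ᶜ) := by rw [Set.union_compl_self, measure_univ]
    _ ≤ P k (F k) + P k (F k)ᶜ := measure_union_le _ _
    _ ≤ _ := by gcongr

/-- Since `s / n → 0`, eventually `s log 9 ≤ n / 256`, so the net cardinality uses at most half of
the exponent `n / 128`. -/
lemma tendsto_badProbability {n p s : ℕ → ℕ} (hn : Tendsto n atTop atTop)
    (hp : Tendsto p atTop atTop) (hs : Tendsto (fun k => (s k : ℝ) / n k) atTop (𝓝 0)) :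
    Tendsto (fun k => ENNReal.ofReal (9 ^ s k * (3 * Real.exp (-(n k : ℝ) / 128)) +
      5 * Real.exp (-Real.log (p k) / 2))) atTop (𝓝 0) := by
  rw [← ENNReal.ofReal_zero]
  apply ENNReal.tendsto_ofReal
  rw [show (0 : ℝ) = 0 + 5 * 0 by norm_num]
  have hn' : Tendsto (fun k => (n k : ℝ)) atTop atTop := tendsto_natCast_atTop_atTop.comp hn
  have hp' : Tendsto (fun k => Real.log (p k)) atTop atTop :=
    Real.tendsto_log_atTop.comp (tendsto_natCast_atTop_atTop.comp hp)
  refine Tendsto.add ?_ (Tendsto.const_mul 5 ?_)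
  · have h1 : Tendsto (fun k => 3 * Real.exp (-((n k : ℝ) / 256))) atTop (𝓝 (3 * 0)) :=
      (Real.tendsto_exp_neg_atTop_nhds_zero.comp (hn'.atTop_div_const (by norm_num))).const_mul 3
    rw [mul_zero] at h1
    refine squeeze_zero' (Eventually.of_forall fun k => by positivity) ?_ h1
    have h9 : 0 < Real.log 9 := Real.log_pos (by norm_num)
    filter_upwards [hs.eventually_lt_const (show 0 < 1 / (256 * Real.log 9) by positivity),
      hn.eventually_gt_atTop 0] with k hk hnk
    have hnk' : (0 : ℝ) < n k := by exact_mod_cast hnk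
    have h2 : (s k : ℝ) * Real.log 9 ≤ n k / 256 := by
      rw [div_lt_div_iff₀ hnk' (by positivity)] at hk
      linarith
    have h3 : (9 : ℝ) ^ s k = Real.exp (s k * Real.log 9) := by
      rw [Real.exp_nat_mul, Real.exp_log (by norm_num)]
    calc (9 : ℝ) ^ s k * (3 * Real.exp (-(n k : ℝ) / 128))
        = 3 * Real.exp (s k * Real.log 9 + -(n k : ℝ) / 128) := by rw [h3, Real.exp_add]; ring
      _ ≤ 3 * Real.exp (-((n k : ℝ) / 256)) := by
        gcongr
        linarith
  · have := Real.tendsto_exp_neg_atTop_nhds_zero.comp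
      (hp'.atTop_div_const (show (0 : ℝ) < 2 by norm_num))
    refine this.congr fun k => ?_
    simp [neg_div]

variable {p : ℕ} (S : Finset (Fin p))

lemma measurable_wMax : Measurable (wMax S) :=
  Measurable.biSup _ (Set.to_countable {j | j ∈ S}) fun j _ => measurable_pi_apply j

lemma measurable_wMin : Measurable (wMin S) :=
  Measurable.biInf _ (Set.to_countable {j | j ∉ S}) fun j _ => measurable_pi_apply j

lemma measurable_rho : Measurable (rho S) := by
  classical
  have h : rho S = fun w => if wMax S w = ∞ then ∞ else wMax S w / wMin S w := by
    ext w; simp only [rho]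
  rw [h]
  exact Measurable.ite (measurableSet_eq_fun (measurable_wMax S) measurable_const)
    measurable_const ((measurable_wMax S).div (measurable_wMin S))

end Asymptotic

end HubNet

/-! ### Support consistency: combining the high-probability events -/

theorem theorem2
    (n p : ℕ → ℕ) (hn : Tendsto n atTop atTop) (hp : Tendsto p atTop atTop)
    -- the core sets, with `s = |S|` satisfying `1 ≤ s ≪ n`
    (S : ∀ k, Finset (Fin (p k))) (hS : ∀ k, (S k).Nonempty)
    (hsn : Tendsto (fun k => ((S k).card : ℝ) / n k) atTop (𝓝 0))
    (Ω : ℕ → Type*) [∀ k, MeasurableSpace (Ω k)]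
    (P : ∀ k, Measure (Ω k)) [∀ k, IsProbabilityMeasure (P k)]
    -- the random design and its covariance
    (Sig : ∀ k, Matrix (Fin (p k)) (Fin (p k)) ℝ)
    (X : ∀ k, Ω k → Fin (n k) → Fin (p k) → ℝ)
    (hX : ∀ k, HubNet.IsHubDesign (P k) (X k) (Sig k) (S k))
    -- `λ_min(Σ_SS) ≥ Cmin`
    (Cmin : ℝ) (hCmin : 0 < Cmin)
    (hSig : ∀ k, ∀ μ ∈ spectrum ℝ
      ((Sig k).submatrix (Subtype.val : S k → Fin (p k)) (Subtype.val : S k → Fin (p k))),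
      Cmin ≤ μ)
    -- the linear model, with Gaussian noise independent of the design
    (σ : ℕ → ℝ≥0) (hσ : ∀ k, 0 < σ k)
    (ε : ∀ k, Ω k → Fin (n k) → ℝ)
    (hε_indep : ∀ k, iIndepFun (fun i ω => ε k ω i) (P k))
    (hε_law : ∀ k i, HasLaw (fun ω => ε k ω i) (gaussianReal 0 (σ k ^ 2)) (P k))
    (hXε : ∀ k, IndepFun (X k) (ε k) (P k))
    (β0 : ℕ → ℝ) (β : ∀ k, Fin (p k) → ℝ)
    -- the weights, derived from the design
    (w : ∀ k, (Fin (n k) → Fin (p k) → ℝ) → Fin (p k) → ℝ≥0∞)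
    (hw_meas : ∀ k, Measurable (w k)) (hw_pos : ∀ k x j, 0 < w k x j)
    -- the weight gap
    (η : ℝ) (hη0 : 0 < η) (hη1 : η ≤ 1)
    (hgap : HubNet.WHP P (fun k => {ω |
      HubNet.rho (S k) (w k (X k ω)) *
        ENNReal.ofReal (√((S k).card / Cmin) * (1 + √(12 * Real.log (p k) / n k)))
        ≤ ENNReal.ofReal (1 - η)}))
    -- the tuning parameter, with `λ_n = λ / n`
    (lam : ∀ k, Ω k → ℝ) (hlam_meas : ∀ k, Measurable (lam k)) (hlam_pos : ∀ k ω, 0 < lam k ω)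
    (hlam_lower : HubNet.LLWHP P
      (fun k ω => (HubNet.wMin (S k) (w k (X k ω)))⁻¹ *
        ENNReal.ofReal (HubNet.noiseLevel (σ k) (n k) (p k)))
      (fun k ω => ENNReal.ofReal (lam k ω / n k)))
    -- the adaptive lasso estimator
    (βhat0 : ∀ k, Ω k → ℝ) (βhat : ∀ k, Ω k → Fin (p k) → ℝ)
    (hβhat : ∀ k, ∀ᵐ ω ∂(P k), HubNet.IsAdaptiveLasso (X k ω)
      (HubNet.response (S k) (β0 k) (β k) (X k ω) (ε k ω)) (lam k ω) (w k (X k ω))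
      (βhat0 k ω) (βhat k ω)) :
    Tendsto (fun k => P k {ω | {i | βhat k ω i ≠ 0} ⊆ (S k : Set (Fin (p k)))}) atTop (𝓝 1) ∧
    -- the beta-min condition and the upper bound on `λ_n`
    (((fun k => σ k * √(((S k).card * Real.log (p k) / n k) * (1 + Real.log (p k) / n k)))
        =o[atTop] (fun k => (S k).inf' (hS k) (fun i => |β k i|))) →
      HubNet.LLWHP P
        (fun k ω => ENNReal.ofReal (lam k ω / n k))
        (fun k ω => ENNReal.ofReal ((S k).inf' (hS k) (fun i => |β k i|)) /
          (HubNet.wMax (S k) (w k (X k ω)) * ENNReal.ofReal (√((S k).card : ℝ)))) →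
      Tendsto (fun k => P k {ω | {i | βhat k ω i ≠ 0} = (S k : Set (Fin (p k)))}) atTop (𝓝 1)) := by
  have hlam_ae (k) : AEMeasurable (fun ω => ENNReal.ofReal (lam k ω / n k)) (P k) :=
    ((hlam_meas k).div_const _).ennreal_ofReal.aemeasurable
  have hwX (k) : AEMeasurable (fun ω => w k (X k ω)) (P k) :=
    (hw_meas k).comp_aemeasurable (hX k).aemeasurable
  have hmax_ae (k) : AEMeasurable (fun ω => HubNet.wMax (S k) (w k (X k ω))) (P k) :=
    (HubNet.measurable_wMax (S k)).comp_aemeasurable (hwX k)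
  have hmin_ae (k) : AEMeasurable (fun ω => HubNet.wMin (S k) (w k (X k ω))) (P k) :=
    (HubNet.measurable_wMin (S k)).comp_aemeasurable (hwX k)
  have hrho_ae (k) : AEMeasurable (fun ω => HubNet.rho (S k) (w k (X k ω))) (P k) :=
    (HubNet.measurable_rho (S k)).comp_aemeasurable (hwX k)
  have hgap0 := hgap.tendsto_compl fun k =>
    nullMeasurableSet_le ((hrho_ae k).mul_const _) aemeasurable_const
  -- With `M = 16/η`, the noise bound `8 n · noiseLevel` is at most `(η/2) λ w_min(Sᶜ)` whenever
  -- `w_min(Sᶜ)` is finite.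
  have hlow0 := (hlam_lower (Real.toNNReal (16 / η))).tendsto_compl fun k =>
    nullMeasurableSet_le (((hmin_ae k).inv.mul_const _).const_mul _) (hlam_ae k)
  have hbad0 := HubNet.tendsto_badProbability hn hp hsn
  have hlogp : ∀ᶠ k in atTop, 1 ≤ Real.log (p k) :=
    (Real.tendsto_log_atTop.comp (tendsto_natCast_atTop_atTop.comp hp)).eventually_ge_atTop 1
  have hsn' : ∀ᶠ k in atTop, 2 * √((S k).card / n k) ≤ η / 4 := by
    have h1 : Tendsto (fun k => 2 * √(((S k).card : ℝ) / n k)) atTop (𝓝 (2 * √0)) :=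
      (hsn.sqrt).const_mul 2
    rw [Real.sqrt_zero, mul_zero] at h1
    exact (h1.eventually_lt_const (show 0 < η / 4 by positivity)).mono fun _ h => h.le
  have hgood : ∀ᶠ k in atTop,
      P k {ω | ¬ HubNet.GoodSample (S k) Cmin (σ k) (X k ω) (ε k ω)} ≤
      ENNReal.ofReal (9 ^ (S k).card * (3 * Real.exp (-(n k : ℝ) / 128)) +
        5 * Real.exp (-Real.log (p k) / 2)) := by
    filter_upwards [hn.eventually_gt_atTop 0, hp.eventually_gt_atTop 0] with k hnk hpk
    exact (hX k).measure_not_goodSample_le hnk hpk hCmin (hSig k) (hσ k) (hε_indep k) (hε_law k)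
      (hXε k)
  have hfit (k) : P k {ω | ¬ HubNet.IsAdaptiveLasso (X k ω)
      (HubNet.response (S k) (β0 k) (β k) (X k ω) (ε k ω)) (lam k ω) (w k (X k ω))
      (βhat0 k ω) (βhat k ω)} = 0 := ae_iff.1 (hβhat k)
  have hzero : ∀ᶠ k in atTop, ∀ ω, HubNet.GoodSample (S k) Cmin (σ k) (X k ω) (ε k ω) →
      HubNet.IsAdaptiveLasso (X k ω)
        (HubNet.response (S k) (β0 k) (β k) (X k ω) (ε k ω)) (lam k ω) (w k (X k ω))
        (βhat0 k ω) (βhat k ω) →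
      HubNet.rho (S k) (w k (X k ω)) *
        ENNReal.ofReal (√((S k).card / Cmin) * (1 + √(12 * Real.log (p k) / n k)))
        ≤ ENNReal.ofReal (1 - η) →
      (Real.toNNReal (16 / η) : ℝ≥0∞) * ((HubNet.wMin (S k) (w k (X k ω)))⁻¹ *
        ENNReal.ofReal (HubNet.noiseLevel (σ k) (n k) (p k))) ≤ ENNReal.ofReal (lam k ω / n k) →
      ∀ j ∉ S k, βhat k ω j = 0 := by
    filter_upwards [hn.eventually_gt_atTop 0, hsn'] with k hnk hsk ω h1 h2 h3 h4
    exact h1.eq_zero_of_notMem hnk (hS k) hCmin (σ k).2 (hw_pos k (X k ω)) (hlam_pos k ω) h2 hη0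
      hη1 h3 h4 hsk
  constructor
  · refine HubNet.tendsto_one_of_compl_le (by simpa only [add_zero] using (hbad0.add hgap0).add hlow0) ?_
    filter_upwards [hzero, hgood] with k hz hg
    refine le_trans ?_ (add_le_add (add_le_add hg le_rfl) le_rfl)
    refine le_trans ?_ (add_le_add (measure_union_le _ _) le_rfl)
    refine le_trans ?_ (measure_union_le _ _)
    refine le_trans ?_ ((add_le_add le_rfl (hfit k).le).trans_eq (add_zero _))
    refine le_trans ?_ (measure_union_le _ _)
    refine measure_mono fun ω hω => ?_
    by_contra hc
    simp only [Set.mem_union, Set.notMem_compl_iff, Set.mem_ofPred_eq, not_or, not_not] at hc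
    refine hω fun i hi => ?_
    by_contra hiS
    exact hi (hz ω hc.1.1.1 hc.2 hc.1.1.2 hc.1.2 i hiS)
  · intro hβmin hup
    -- With `M = 8/Cmin`, the penalty bias `√s λ w_max(S) / (n Cmin / 2)` is at most `β_min / 4`.
    have hup0 := (hup (Real.toNNReal (8 / Cmin))).tendsto_compl fun k =>
      nullMeasurableSet_le ((hlam_ae k).const_mul _)
        (AEMeasurable.div aemeasurable_const ((hmax_ae k).mul_const _))
    refine HubNet.tendsto_one_of_compl_le
      (by simpa only [add_zero] using ((hbad0.add hgap0).add hlow0).add hup0) ?_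
    have hsig := hβmin.def (show 0 < √Cmin / 16 by positivity)
    filter_upwards [hzero, hgood, hsig, hlogp, hn.eventually_gt_atTop 0]
      with k hz hg hsk hLk hnk
    have hnk' : (0 : ℝ) < n k := by exact_mod_cast hnk
    have hcard : (0 : ℝ) < (S k).card := by exact_mod_cast (hS k).card_pos
    have hσk : (0 : ℝ) < σ k := hσ k
    set βmin := (S k).inf' (hS k) fun i => |β k i| with hβdef
    have hβnn : 0 ≤ βmin := (Finset.le_inf'_iff _ _).2 fun i _ => abs_nonneg _
    have hsig1 : σ k * √(((S k).card * Real.log (p k) / n k) * (1 + Real.log (p k) / n k)) ≤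
        √Cmin / 16 * βmin := by
      rwa [Real.norm_of_nonneg (by positivity), Real.norm_of_nonneg hβnn] at hsk
    -- Once `log p ≥ 1` the noise side is positive, so the asymptotic signal condition forces a
    -- positive minimum.
    have hβpos : 0 < βmin := by
      have h1 : 0 < σ k * √(((S k).card * Real.log (p k) / n k) * (1 + Real.log (p k) / n k)) := by
        positivity
      exact pos_of_mul_pos_right (h1.trans_le hsig1) (by positivity)
    refine le_trans ?_ (add_le_add (add_le_add (add_le_add hg le_rfl) le_rfl) le_rfl)
    refine le_trans ?_ (add_le_add (add_le_add (measure_union_le _ _) le_rfl) le_rfl)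
    refine le_trans ?_ (add_le_add (measure_union_le _ _) le_rfl)
    refine le_trans ?_ (measure_union_le _ _)
    refine le_trans ?_ ((add_le_add le_rfl (hfit k).le).trans_eq (add_zero _))
    refine le_trans ?_ (measure_union_le _ _)
    refine measure_mono fun ω hω => ?_
    by_contra hc
    simp only [Set.mem_union, Set.notMem_compl_iff, Set.mem_ofPred_eq, not_or, not_not] at hc
    have hb := hz ω hc.1.1.1.1 hc.2 hc.1.1.1.2 hc.1.1.2
    have hb2 := hc.1.1.1.1.ne_zero_of_mem hnk (hS k) hLk hCmin hσk.le (hlam_pos k ω) hc.2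
      (HubNet.wMax_ne_top_of_rho (by positivity) hc.1.1.1.2) hb hβpos
      (fun j hj => Finset.inf'_le _ hj) hsig1 hc.1.2
    refine hω (Set.ext fun i => ⟨fun hi => ?_, fun hi => hb2 i hi⟩)
    by_contra hiS
    exact hi (hb i hiS)
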